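/- Let $n\ge 2$. On $\mathbb R^{2n+2}$, with points $z=(x^1,\dots,x^{n+1};y^1,\dots,y^{n+1})$, let $J'(x;y)=(-y;x)$, $g'(z,z')=\sum_i (x^i x'^i-y^i y'^i)$ and $\widetilde g'=g'(\cdot,J'\cdot)$. For $z_0\in\mathbb R^{2n+2}$ and $(a,b)\in\mathbb R^2$, $(a,b)\ne(0,0)$, let $S=S^{2n}(z_0;a,b)=\{z: g'(z-z_0,z-z_0)=a,\ \widetilde g'(z-z_0,z-z_0)=b\}$ be the h-sphere, a holomorphic hypersurface (it is covered by holomorphic charts), with the induced complex structure $J$ and the induced pseudo-Riemannian (Norden) metric $g$. Let $X^H, X^V$ denote the horizontal (with respect to the Levi-Civita connection of $g$) and vertical lifts to the tangent bundle $TS$. Equip $TS$ with the complete lift $\widehat g$ of $g$, $$\widehat g(X^H,Y^H)=\widehat g(X^V,Y^V)=0,\qquad \widehat g(X^H,Y^V)=\widehat g(X^V,Y^H)=g(X,Y),$$ and with the almost hypercomplex structure $H=(J_1,J_2,J_3)$ given by $$J_1X^H=-(JX)^H,\ J_1X^V=(JX)^V;\quad J_2X^H=X^V,\ J_2X^V=-X^H;\quad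 J_3X^H=(JX)^V,\ J_3X^V=(JX)^H.$$ The sectional curvature of $\widehat g$ on a nondegenerate 2-plane with basis $\zeta,\omega$ is $\widehat k(\zeta,\omega)=\frac{\widehat g(\widehat R(\zeta,\omega)\omega,\zeta)}{\widehat g(\zeta,\zeta)\widehat g(\omega,\omega)-\widehat g(\zeta,\omega)^2}$, where $\widehat R(X,Y)Z=\widehat\nabla_X\widehat\nabla_YZ-\widehat\nabla_Y\widehat\nabla_XZ-\widehat\nabla_{[X,Y]}Z$ for the Levi-Civita connection $\widehat\nabla$ of $\widehat g$. A 2-plane $\beta$ is $J_\alpha$-holomorphic if $J_\alpha\beta=\beta$, and $J_\alpha$-totally-real if $\beta\perp J_\alpha\beta\ne\beta$ with respect to $\widehat g$. Then, at every $p\in S$ and $u\in T_pS$ (regarded as a point of $TS$): 1. Every nondegenerate $J_\alpha$-holomorphic 2-plane in $T_u(TS)$ has $\widehat k=0$, for each $\alpha=1,2,3$. 2. Let $\{e_i, e_{\bar i}=Je_i\}_{i=1}^n$ be an orthonormal $J$-basis of $T_pS$ (pairwise orthogonal vectors of square $\pm1$), and put $\xi(X)=\frac1{\sqrt2}(X^H+X^V)$,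 $\eta(X)=\frac1{\sqrt2}(X^H-X^V)$, $\xi_i=\xi(e_i)$, $\xi_{\bar i}=\xi(e_{\bar i})$, $\eta_i=\eta(e_i)$, $\eta_{\bar i}=\eta(e_{\bar i})$. For $i\ne j$, $X\in\{e_i,e_{\bar i}\}$ and $Y\in\{e_j,e_{\bar j}\}$, the planes spanned by $\{\xi(X),\xi(Y)\}$, $\{\eta(X),\eta(Y)\}$, $\{\xi(X),\eta(Y)\}$ are nondegenerate and $J_\alpha$-totally-real for all $\alpha=1,2,3$, and $$\widehat k(\xi(X),\xi(Y))=\frac{a}{a^2+b^2},\qquad \widehat k(\eta(X),\eta(Y))=-\frac{a}{a^2+b^2},\qquad \widehat k(\xi(X),\eta(Y))=0 .$$ 3. For each $i$, the remaining basic planes, namely $\{\xi_{\bar i},\eta_i\},\{\eta_{\bar i},\xi_i\}$ (with $\beta=1$), $\{\eta_i,\xi_i\},\{\eta_{\bar i},\xi_{\bar i}\}$ (with $\beta=2$), $\{\xi_i,\xi_{\bar i}\},\{\eta_{\bar i},\eta_i\}$ (with $\beta=3$), are nondegenerate, $J_\beta$-holomorphic, $J_\alpha$-totally-real for the two indices $\alpha\neq\beta$,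 and have $\widehat k=0$. -/

import Mathlib

open scoped ContDiff

set_option maxSynthPendingDepth 3

noncomputable section

namespace PseudoRiem

/-! Pseudo-Riemannian geometry on (open subsets of) a finite-dimensional real vector space `E`,
i.e. in a coordinate chart. A metric is a field `G` of bilinear forms; all the objects at `x` depend
only on the germ of `G` at `x`. -/

variable {E : Type*} [NormedAddCommGroup E] [NormedSpace ℝ E]

/-- The covector field `2⁻¹ (∂_X G(Y,·) + ∂_Y G(X,·) - ∂_· G(X,Y))`, for constant fields `X`, `Y`
(Christoffel symbols of the first kind). -/
def koszul (G : E → E →L[ℝ] E →L[ℝ] ℝ) (x : E) : E →L[ℝ] E →L[ℝ] E →L[ℝ] ℝ :=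
  let D : E →L[ℝ] E →L[ℝ] E →L[ℝ] ℝ := fderiv ℝ G x
  let T : (E →L[ℝ] E →L[ℝ] ℝ) →L[ℝ] (E →L[ℝ] E →L[ℝ] ℝ) :=
    (ContinuousLinearMap.flipₗᵢ ℝ E E ℝ).toContinuousLinearEquiv
  (2⁻¹ : ℝ) • (D + D.flip - T ∘L D.flip)

theorem koszul_apply (G : E → E →L[ℝ] E →L[ℝ] ℝ) (x X Y Z : E) :
    koszul G x X Y Z
      = 2⁻¹ * (fderiv ℝ G x X Y Z + fderiv ℝ G x Y X Z - fderiv ℝ G x Z X Y) := by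
  simp [koszul]

/-- The Christoffel symbols `Γ_x(X,Y)` of the Levi-Civita connection of `G`: where `G x` is
nondegenerate, `Γ_x(X,Y)` is the vector with `G x (Γ_x(X,Y)) Z = koszul G x X Y Z` for all `Z`. For
vector fields, `∇_X Y = ∂_X Y + Γ(X,Y)`. -/
def christoffel (G : E → E →L[ℝ] E →L[ℝ] ℝ) (x : E) : E →L[ℝ] E →L[ℝ] E :=
  (ContinuousLinearMap.compL ℝ E (E →L[ℝ] ℝ) E (G x).inverse) ∘L koszul G x

theorem christoffel_apply (G : E → E →L[ℝ] E →L[ℝ] ℝ) (x X Y : E) :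
    christoffel G x X Y = (G x).inverse (koszul G x X Y) := rfl

/-- The defining property of the Christoffel symbols of a nondegenerate metric. -/
theorem metric_christoffel (G : E → E →L[ℝ] E →L[ℝ] ℝ) (x : E)
    (h : (G x).IsInvertible) (X Y Z : E) :
    G x (christoffel G x X Y) Z = koszul G x X Y Z := by
  obtain ⟨e, he⟩ := h
  rw [christoffel_apply, ← he]
  simp

/-- The curvature `R(X,Y)Z = ∇_X ∇_Y Z - ∇_Y ∇_X Z - ∇_[X,Y] Z` of the Levi-Civita connection at `x`,
computed on constant vector fields. -/
def curvature (G : E → E →L[ℝ] E →L[ℝ] ℝ) (x X Y Z : E) : E :=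
  fderiv ℝ (fun y => christoffel G y Y Z) x X - fderiv ℝ (fun y => christoffel G y X Z) x Y
    + christoffel G x X (christoffel G x Y Z) - christoffel G x Y (christoffel G x X Z)

/-- `π₁(X,Y,Y,X)`; the plane spanned by `X`, `Y` is a nondegenerate 2-plane iff this is nonzero. -/
def gramDet (G : E → E →L[ℝ] E →L[ℝ] ℝ) (x X Y : E) : ℝ :=
  G x Y Y * G x X X - G x X Y ^ 2

/-- The sectional curvature `R(X,Y,Y,X) / π₁(X,Y,Y,X)` at `x` of the (nondegenerate) plane spanned by
`X` and `Y`. -/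
def sectionalCurvature (G : E → E →L[ℝ] E →L[ℝ] ℝ) (x X Y : E) : ℝ :=
  G x (curvature G x X Y Y) X / gramDet G x X Y

/-- A subspace `P` is holomorphic for the endomorphism `J` if `J P = P`. -/
def IsHolomorphicPlane (J : E →L[ℝ] E) (P : Submodule ℝ E) : Prop :=
  P.map (J : E →ₗ[ℝ] E) = P

/-- A subspace `P` is totally real for `J` and the bilinear form `B` if `P ⊥ J P ≠ P`. -/
def IsTotallyRealPlane (B : E →L[ℝ] E →L[ℝ] ℝ) (J : E →L[ℝ] E) (P : Submodule ℝ E) : Prop :=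
  (∀ X ∈ P, ∀ Y ∈ P, B X (J Y) = 0) ∧ P.map (J : E →ₗ[ℝ] E) ≠ P

/-! The tangent bundle in the induced coordinates: the point `(x, u) : E × E` stands for the tangent
vector with components `u` at the point `x`, and tangent vectors at `(x, u)` are again in `E × E`. -/

/-- The horizontal lift of `X` to the point `p = (x, u)`, with respect to the Levi-Civita connection
of `G`. -/
def hLift (G : E → E →L[ℝ] E →L[ℝ] ℝ) (p : E × E) : E →L[ℝ] E × E :=
  (ContinuousLinearMap.id ℝ E).prod (-(christoffel G p.1).flip p.2)

/-- The vertical lift of `X` (to any point). -/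
def vLift : E →L[ℝ] E × E := ContinuousLinearMap.inr ℝ E E

/-- The connection map at `p = (x, u)`: the vertical component of a tangent vector of the tangent
bundle. -/
def vPart (G : E → E →L[ℝ] E →L[ℝ] ℝ) (p : E × E) : E × E →L[ℝ] E :=
  ContinuousLinearMap.snd ℝ E E + (christoffel G p.1).flip p.2 ∘L ContinuousLinearMap.fst ℝ E E

theorem hLift_apply (G : E → E →L[ℝ] E →L[ℝ] ℝ) (p : E × E) (X : E) :
    hLift G p X = (X, -christoffel G p.1 X p.2) := rfl

theorem vLift_apply (X : E) : vLift X = ((0, X) : E × E) := rfl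

@[simp] theorem fst_hLift (G : E → E →L[ℝ] E →L[ℝ] ℝ) (p : E × E) (X : E) :
    (hLift G p X).1 = X := rfl

@[simp] theorem fst_vLift (X : E) : (vLift X : E × E).1 = 0 := rfl

@[simp] theorem vPart_hLift (G : E → E →L[ℝ] E →L[ℝ] ℝ) (p : E × E) (X : E) :
    vPart G p (hLift G p X) = 0 := by
  simp [vPart, hLift_apply]

@[simp] theorem vPart_vLift (G : E → E →L[ℝ] E →L[ℝ] ℝ) (p : E × E) (X : E) :
    vPart G p (vLift X) = X := by
  simp [vPart, vLift_apply]

/-- Every tangent vector of the tangent bundle is `X^H + Y^V` for unique `X`, `Y`. -/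
theorem hLift_add_vLift (G : E → E →L[ℝ] E →L[ℝ] ℝ) (p ζ : E × E) :
    hLift G p ζ.1 + vLift (vPart G p ζ) = ζ := by
  ext <;> simp [vPart, hLift_apply, vLift_apply]

/-- The complete lift of the metric `G` to the tangent bundle; it is characterized by
`completeLift_lifts` below. -/
def completeLift (G : E → E →L[ℝ] E →L[ℝ] ℝ) (p : E × E) : E × E →L[ℝ] E × E →L[ℝ] ℝ :=
  (G p.1).bilinearComp (ContinuousLinearMap.fst ℝ E E) (vPart G p)
    + (G p.1).bilinearComp (vPart G p) (ContinuousLinearMap.fst ℝ E E)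

theorem completeLift_lifts (G : E → E →L[ℝ] E →L[ℝ] ℝ) (p : E × E) (X Y : E) :
    completeLift G p (hLift G p X) (hLift G p Y) = 0 ∧
    completeLift G p (vLift X) (vLift Y) = 0 ∧
    completeLift G p (hLift G p X) (vLift Y) = G p.1 X Y ∧
    completeLift G p (vLift X) (hLift G p Y) = G p.1 X Y := by
  simp [completeLift]

/-- The almost hypercomplex structure `H = (J₁, J₂, J₃)` on the tangent bundle (indexed by
`0, 1, 2 : Fin 3`) induced by the Levi-Civita connection of `G` and the almost complex structure `J`,
here constant in the coordinates; see `hyper_lifts`. -/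
def hyper (G : E → E →L[ℝ] E →L[ℝ] ℝ) (J : E →L[ℝ] E) (p : E × E) : Fin 3 → (E × E →L[ℝ] E × E) :=
  ![-(hLift G p ∘L J ∘L ContinuousLinearMap.fst ℝ E E) + vLift ∘L J ∘L vPart G p,
    vLift ∘L ContinuousLinearMap.fst ℝ E E - hLift G p ∘L vPart G p,
    vLift ∘L J ∘L ContinuousLinearMap.fst ℝ E E + hLift G p ∘L J ∘L vPart G p]

theorem hyper_lifts (G : E → E →L[ℝ] E →L[ℝ] ℝ) (J : E →L[ℝ] E) (p : E × E) (X : E) :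
    hyper G J p 0 (hLift G p X) = -hLift G p (J X) ∧ hyper G J p 0 (vLift X) = vLift (J X) ∧
    hyper G J p 1 (hLift G p X) = vLift X ∧ hyper G J p 1 (vLift X) = -hLift G p X ∧
    hyper G J p 2 (hLift G p X) = vLift (J X) ∧ hyper G J p 2 (vLift X) = hLift G p (J X) := by
  simp [hyper]

/-- `ξ(X) = (X^H + X^V)/√2` at the point `p` of the tangent bundle. -/
def xi (G : E → E →L[ℝ] E →L[ℝ] ℝ) (p : E × E) (X : E) : E × E :=
  (1 / √2 : ℝ) • (hLift G p X + vLift X)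

/-- `η(X) = (X^H - X^V)/√2` at the point `p` of the tangent bundle. -/
def eta (G : E → E →L[ℝ] E →L[ℝ] ℝ) (p : E × E) (X : E) : E × E :=
  (1 / √2 : ℝ) • (hLift G p X - vLift X)

/-- An orthonormal `J`-basis `e_i, J e_i` of the tangent space at `x`, `e_i` being indexed by
`ι`: the vectors `e_i, J e_i` are pairwise orthogonal of square `±1`. (The family is automatically
linearly independent; it is a basis because `ι` is taken with `2 |ι| = dim E`.) -/
def IsOrthonormalJBasis {ι : Type*} (G : E → E →L[ℝ] E →L[ℝ] ℝ) (J : E →L[ℝ] E) (x : E)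
    (e : ι → E) : Prop :=
  (∀ i, G x (e i) (e i) = 1 ∨ G x (e i) (e i) = -1) ∧
  (∀ i, G x (J (e i)) (J (e i)) = 1 ∨ G x (J (e i)) (J (e i)) = -1) ∧
  (∀ i j, i ≠ j → G x (e i) (e j) = 0) ∧
  (∀ i j, i ≠ j → G x (J (e i)) (J (e j)) = 0) ∧
  (∀ i j, G x (e i) (J (e j)) = 0)

end PseudoRiem

/-- The space `ℝ^{2m}` of pairs `(x¹,…,x^m; y¹,…,y^m)`. -/
abbrev NordenSpace (m : ℕ) : Type := (Fin m → ℝ) × (Fin m → ℝ)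

namespace NordenSpace

/-- The standard complex structure `J(x; y) = (-y; x)`. -/
def J (m : ℕ) : NordenSpace m →L[ℝ] NordenSpace m :=
  (-ContinuousLinearMap.snd ℝ (Fin m → ℝ) (Fin m → ℝ)).prod
    (ContinuousLinearMap.fst ℝ (Fin m → ℝ) (Fin m → ℝ))

theorem J_apply (m : ℕ) (z : NordenSpace m) : J m z = (-z.2, z.1) := rfl

/-- The standard Norden metric `g(z, z') = ∑ (xᵢ x'ᵢ - yᵢ y'ᵢ)` of signature `(m, m)`. -/
def g (m : ℕ) : NordenSpace m →L[ℝ] NordenSpace m →L[ℝ] ℝ :=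
  ∑ i : Fin m,
    ((ContinuousLinearMap.proj i ∘L
          ContinuousLinearMap.fst ℝ (Fin m → ℝ) (Fin m → ℝ)).smulRight
        (ContinuousLinearMap.proj i ∘L ContinuousLinearMap.fst ℝ (Fin m → ℝ) (Fin m → ℝ))
      - (ContinuousLinearMap.proj i ∘L
          ContinuousLinearMap.snd ℝ (Fin m → ℝ) (Fin m → ℝ)).smulRight
        (ContinuousLinearMap.proj i ∘L ContinuousLinearMap.snd ℝ (Fin m → ℝ) (Fin m → ℝ)))

theorem g_apply (m : ℕ) (z w : NordenSpace m) :
    g m z w = ∑ i, (z.1 i * w.1 i - z.2 i * w.2 i) := by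
  simp [g]

end NordenSpace

/-- The h-sphere with center `z₀` and parameters `a`, `b` in `ℝ^{2n+2}`:
`g(z-z₀, z-z₀) = a` and `g̃(z-z₀, z-z₀) = b`, where `g̃ = g(·, J·)`. -/
def hSphere (n : ℕ) (z₀ : NordenSpace (n + 1)) (a b : ℝ) : Set (NordenSpace (n + 1)) :=
  {z | NordenSpace.g (n + 1) (z - z₀) (z - z₀) = a ∧
    NordenSpace.g (n + 1) (z - z₀) (NordenSpace.J (n + 1) (z - z₀)) = b}

/-- A holomorphic local parametrization `φ` (the inverse of a complex chart) of the h-sphere, with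
domain `U ⊆ ℝ^{2n}`: a smooth injective immersion into the h-sphere whose differential commutes with
the complex structures (as the dimensions agree, it is then a diffeomorphism onto an open part of the
h-sphere, and `fderiv ℝ φ x` maps `ℝ^{2n}` onto the tangent space). Thus `J` of `ℝ^{2n}` is the coordinate expression of the complex structure
of the h-sphere, which is the restriction of `J` of `ℝ^{2n+2}`. -/
structure HSphereChart (n : ℕ) (z₀ : NordenSpace (n + 1)) (a b : ℝ) where
  U : Set (NordenSpace n)
  isOpen_U : IsOpen U
  φ : NordenSpace n → NordenSpace (n + 1)
  contDiffOn : ContDiffOn ℝ ∞ φ U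
  injOn : Set.InjOn φ U
  mapsTo : Set.MapsTo φ U (hSphere n z₀ a b)
  immersion : ∀ x ∈ U, Function.Injective (fderiv ℝ φ x)
  holomorphic : ∀ x ∈ U, ∀ v,
    fderiv ℝ φ x (NordenSpace.J n v) = NordenSpace.J (n + 1) (fderiv ℝ φ x v)

/-- The metric induced on the h-sphere by `g` of `ℝ^{2n+2}`, in the chart: the pull-back `φ^* g`. -/
def HSphereChart.metric {n : ℕ} {z₀ : NordenSpace (n + 1)} {a b : ℝ} (c : HSphereChart n z₀ a b)
    (x : NordenSpace n) : NordenSpace n →L[ℝ] NordenSpace n →L[ℝ] ℝ :=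
  (NordenSpace.g (n + 1)).bilinearComp (fderiv ℝ c.φ x) (fderiv ℝ c.φ x)

/-- The metric `ĝ` of the tangent bundle of the h-sphere, i.e. the complete lift of the metric of the
h-sphere, in the coordinates induced by the chart. -/
def HSphereChart.gHat {n : ℕ} {z₀ : NordenSpace (n + 1)} {a b : ℝ} (c : HSphereChart n z₀ a b) :
    NordenSpace n × NordenSpace n →
      (NordenSpace n × NordenSpace n →L[ℝ] NordenSpace n × NordenSpace n →L[ℝ] ℝ) :=
  PseudoRiem.completeLift c.metric

/-- The almost hypercomplex structure `H = (J₁, J₂, J₃)` of the tangent bundle of the h-sphere, in the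
coordinates induced by the chart, with indices `0, 1, 2 : Fin 3`. -/
def HSphereChart.hyper {n : ℕ} {z₀ : NordenSpace (n + 1)} {a b : ℝ} (c : HSphereChart n z₀ a b)
    (p : NordenSpace n × NordenSpace n) :
    Fin 3 → (NordenSpace n × NordenSpace n →L[ℝ] NordenSpace n × NordenSpace n) :=
  PseudoRiem.hyper c.metric (NordenSpace.J n) p

/-- The plane spanned by `ζ₁` and `ζ₂` is nondegenerate and totally real for `J_α`, at the point `p` of
the tangent bundle of the h-sphere. -/
def HSphereChart.TotallyReal {n : ℕ} {z₀ : NordenSpace (n + 1)} {a b : ℝ}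
    (c : HSphereChart n z₀ a b) (p : NordenSpace n × NordenSpace n) (α : Fin 3)
    (ζ₁ ζ₂ : NordenSpace n × NordenSpace n) : Prop :=
  PseudoRiem.gramDet c.gHat p ζ₁ ζ₂ ≠ 0 ∧
    PseudoRiem.IsTotallyRealPlane (c.gHat p) (c.hyper p α) (Submodule.span ℝ {ζ₁, ζ₂})

/-- The plane spanned by `ζ₁` and `ζ₂` is nondegenerate and holomorphic for `J_α`, at the point `p` of
the tangent bundle of the h-sphere. -/
def HSphereChart.Holomorphic {n : ℕ} {z₀ : NordenSpace (n + 1)} {a b : ℝ}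
    (c : HSphereChart n z₀ a b) (p : NordenSpace n × NordenSpace n) (α : Fin 3)
    (ζ₁ ζ₂ : NordenSpace n × NordenSpace n) : Prop :=
  PseudoRiem.gramDet c.gHat p ζ₁ ζ₂ ≠ 0 ∧
    PseudoRiem.IsHolomorphicPlane (c.hyper p α) (Submodule.span ℝ {ζ₁, ζ₂})

/-- The sectional curvature `k̂` of the tangent bundle of the h-sphere, at its point `p`, of the plane
spanned by `ζ₁` and `ζ₂`. -/
def HSphereChart.kHat {n : ℕ} {z₀ : NordenSpace (n + 1)} {a b : ℝ} (c : HSphereChart n z₀ a b)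
    (p ζ₁ ζ₂ : NordenSpace n × NordenSpace n) : ℝ :=
  PseudoRiem.sectionalCurvature c.gHat p ζ₁ ζ₂

end

/-! The h-sphere lies in a flat space, and so does its tangent bundle: the complete lift of a
pull-back metric is the pull-back, under the tangent map `(x, u) ↦ (Φ x, dΦ_x u)`, of the constant
form `tangentForm B` on `F × F` (`IsPullbackMetric.completeLift`). The curvature of `ĝ` is therefore
given by the Gauss equation for an immersion of codimension 4 (`gauss_equation`), and no derivative
of curvature or bracket of lifts has to be computed.

Write `P` for the position vector relative to the center. The normal space of the tangent bundle is
spanned by the complete and the vertical lifts of `P` and `JP`. Each of these is a self-adjoint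
linear operator applied to the tangent map, and each operator defines a quadric containing the
image; differentiating the quadric equation twice gives the corresponding component of the second
fundamental form (`secondForm_quadric`). The Gram matrix of the four normals consists of two
off-diagonal blocks `[[a, b], [b, -a]]`, whose square is `a² + b²`; this yields the closed formula
`gaussForm`.

Conceptually, put `μ = m - i m(·, J·)` with `m` the metric of the h-sphere, and extend it to `X^H +
X'^V ↔ X + εX'`, `ε² = 0`, by `q(v, w) = μ(X, Y) + ε(μ(X, Y') + μ(X', Y))`. Then `gaussForm` is the
`ε`-part of `Re((a + ib) q(v₁, v₂) q(v₃, v₄))`: the h-sphere is the complex sphere `∑ z² = a - ib`,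
of complex curvature `1/(a - ib)`, and the tangent bundle is its extension to dual numbers. The
numerator of `k̂` comes from `q(v, v) q(w, w) - q(v, w)²`. Its `ε`-part vanishes for `w = J_α v`,
hence on holomorphic planes. For `ξ(X)` and `η(X)` one has `q(v, v) = ½ μ(X, X)(1 ± 2ε)`; on basic
planes with two different indices `q(v, w) = 0` and the `ε`-parts add up or cancel, which gives the
values `±a/(a² + b²)` and `0`. -/

namespace PseudoRiem

/-! ### Pull-back metrics and the Gauss equation -/

section Gauss

variable {E F : Type*} [NormedAddCommGroup E] [NormedSpace ℝ E]
  [NormedAddCommGroup F] [NormedSpace ℝ F]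

/-- On the open set `U`, the field `G` is a nondegenerate metric, the pull-back under the smooth map
`Φ` of the constant symmetric bilinear form `B`. -/
structure IsPullbackMetric (G : E → E →L[ℝ] E →L[ℝ] ℝ) (B : F →L[ℝ] F →L[ℝ] ℝ) (Φ : E → F)
    (U : Set E) : Prop where
  isOpen : IsOpen U
  contDiffOn : ContDiffOn ℝ ∞ Φ U
  symm : ∀ v w, B v w = B w v
  apply_eq : ∀ x ∈ U, ∀ X Y, G x X Y = B (fderiv ℝ Φ x X) (fderiv ℝ Φ x Y)
  isInvertible : ∀ x ∈ U, (G x).IsInvertible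

/-- The second fundamental form of the map `Φ` with respect to the metric `G` of its source. -/
noncomputable def secondForm (G : E → E →L[ℝ] E →L[ℝ] ℝ) (Φ : E → F) (x X Y : E) : F :=
  fderiv ℝ (fderiv ℝ Φ) x X Y - fderiv ℝ Φ x (christoffel G x X Y)

theorem contDiffAt_fderiv_of_isOpen {Φ : E → F} {U : Set E} (hU : IsOpen U)
    (h : ContDiffOn ℝ ∞ Φ U) {x : E} (hx : x ∈ U) : ContDiffAt ℝ ∞ (fderiv ℝ Φ) x :=
  (h.contDiffAt (hU.mem_nhds hx)).fderiv_right (by simp)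

theorem contDiffAt_fderiv_fderiv_of_isOpen {Φ : E → F} {U : Set E} (hU : IsOpen U)
    (h : ContDiffOn ℝ ∞ Φ U) {x : E} (hx : x ∈ U) :
    ContDiffAt ℝ ∞ (fderiv ℝ (fderiv ℝ Φ)) x :=
  (contDiffAt_fderiv_of_isOpen hU h hx).fderiv_right (by simp)

theorem fderiv_fderiv_symm_of_isOpen {Φ : E → F} {U : Set E} (hU : IsOpen U)
    (h : ContDiffOn ℝ ∞ Φ U) {x : E} (hx : x ∈ U) (X Y : E) :
    fderiv ℝ (fderiv ℝ Φ) x X Y = fderiv ℝ (fderiv ℝ Φ) x Y X :=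
  (h.contDiffAt (hU.mem_nhds hx)).isSymmSndFDerivAt (by simp; decide) X Y

/-- The derivative of `y ↦ B (f y) (g y)` for a constant bilinear form `B`. -/
theorem fderiv_bilin {F' : Type*} [NormedAddCommGroup F'] [NormedSpace ℝ F']
    (B : F →L[ℝ] F' →L[ℝ] ℝ) {f : E → F} {g : E → F'} {x : E}
    (hf : DifferentiableAt ℝ f x) (hg : DifferentiableAt ℝ g x) (X : E) :
    fderiv ℝ (fun y => B (f y) (g y)) x X = B (fderiv ℝ f x X) (g x) + B (f x) (fderiv ℝ g x X) := by
  rw [B.fderiv_of_bilinear hf hg]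
  simp [add_comm]

theorem fderiv_clm_apply_const {f : E → E →L[ℝ] F} {x : E}
    (hf : DifferentiableAt ℝ f x) (X Y : E) :
    fderiv ℝ (fun y => f y Y) x X = fderiv ℝ f x X Y := by
  rw [fderiv_clm_apply hf (differentiableAt_const Y)]
  simp

variable {G : E → E →L[ℝ] E →L[ℝ] ℝ} {B : F →L[ℝ] F →L[ℝ] ℝ} {Φ : E → F} {U : Set E}

namespace IsPullbackMetric

theorem differentiableAt_fderiv (h : IsPullbackMetric G B Φ U) {x : E} (hx : x ∈ U) :
    DifferentiableAt ℝ (fderiv ℝ Φ) x :=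
  (contDiffAt_fderiv_of_isOpen h.isOpen h.contDiffOn hx).differentiableAt (by simp)

theorem contDiffAt_metric (h : IsPullbackMetric G B Φ U) {x : E} (hx : x ∈ U) :
    ContDiffAt ℝ ∞ G x := by
  have hψ := contDiffAt_fderiv_of_isOpen h.isOpen h.contDiffOn hx
  let T : (E →L[ℝ] F →L[ℝ] ℝ) →L[ℝ] (F →L[ℝ] E →L[ℝ] ℝ) :=
    (ContinuousLinearMap.flipₗᵢ ℝ E F ℝ).toContinuousLinearEquiv
  let T' : (E →L[ℝ] E →L[ℝ] ℝ) →L[ℝ] (E →L[ℝ] E →L[ℝ] ℝ) :=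
    (ContinuousLinearMap.flipₗᵢ ℝ E E ℝ).toContinuousLinearEquiv
  have h1 : ContDiffAt ℝ ∞
      (fun y => T' ((T (B ∘L fderiv ℝ Φ y)) ∘L fderiv ℝ Φ y)) x := by
    fun_prop
  refine h1.congr_of_eventuallyEq ?_
  filter_upwards [h.isOpen.mem_nhds hx] with y hy
  ext X Y
  rw [h.apply_eq y hy]
  rfl

/-- Differentiating `G = B(dΦ, dΦ)` gives two Hessian terms for each of the three derivatives; by
symmetry of the Hessian and of `B`, four of the six cancel in the Koszul combination and the other
two coincide. -/
theorem koszul_eq (h : IsPullbackMetric G B Φ U) {x : E} (hx : x ∈ U) (X Y Z : E) :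
    koszul G x X Y Z = B (fderiv ℝ (fderiv ℝ Φ) x X Y) (fderiv ℝ Φ x Z) := by
  have hψ := h.differentiableAt_fderiv hx
  have hG : DifferentiableAt ℝ G x := (h.contDiffAt_metric hx).differentiableAt (by simp)
  have key : ∀ X Y Z, fderiv ℝ G x X Y Z =
      B (fderiv ℝ (fderiv ℝ Φ) x X Y) (fderiv ℝ Φ x Z)
        + B (fderiv ℝ Φ x Y) (fderiv ℝ (fderiv ℝ Φ) x X Z) := by
    intro X Y Z
    have e1 : fderiv ℝ G x X Y Z = fderiv ℝ (fun y => G y Y Z) x X := by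
      rw [fderiv_clm_apply_const (f := fun y => G y Y) (by fun_prop), fderiv_clm_apply_const hG]
    have e2 : (fun y => G y Y Z) =ᶠ[nhds x] fun y => B (fderiv ℝ Φ y Y) (fderiv ℝ Φ y Z) := by
      filter_upwards [h.isOpen.mem_nhds hx] with y hy
      exact h.apply_eq y hy Y Z
    rw [e1, e2.fderiv_eq, fderiv_bilin B (by fun_prop) (by fun_prop),
      fderiv_clm_apply_const hψ, fderiv_clm_apply_const hψ]
  have hs := fderiv_fderiv_symm_of_isOpen h.isOpen h.contDiffOn hx
  rw [koszul_apply, key, key, key, hs Z X, hs Z Y, hs Y X, h.symm (fderiv ℝ Φ x Y),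
    h.symm (fderiv ℝ Φ x X)]
  ring

/-- The second fundamental form is normal. -/
theorem secondForm_normal (h : IsPullbackMetric G B Φ U) {x : E} (hx : x ∈ U) (X Y Z : E) :
    B (secondForm G Φ x X Y) (fderiv ℝ Φ x Z) = 0 := by
  rw [secondForm, map_sub, sub_apply, ← h.apply_eq x hx,
    metric_christoffel G x (h.isInvertible x hx), h.koszul_eq hx, sub_self]

theorem metric_christoffel_eq (h : IsPullbackMetric G B Φ U) {x : E} (hx : x ∈ U) (X Y Z : E) :
    G x (christoffel G x X Y) Z = B (fderiv ℝ (fderiv ℝ Φ) x X Y) (fderiv ℝ Φ x Z) := by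
  rw [metric_christoffel G x (h.isInvertible x hx), h.koszul_eq hx]

theorem differentiableAt_christoffel [CompleteSpace E] (h : IsPullbackMetric G B Φ U) {x : E}
    (hx : x ∈ U) : DifferentiableAt ℝ (christoffel G) x := by
  have hG := h.contDiffAt_metric hx
  have hD : DifferentiableAt ℝ (fderiv ℝ G) x :=
    (hG.fderiv_right (m := ∞) (by simp)).differentiableAt (by simp)
  have hi : DifferentiableAt ℝ (fun y => (G y).inverse) x :=
    (((h.isInvertible x hx).contDiffAt_map_inverse (n := ∞)).comp x hG).differentiableAt (by simp)
  have hD' : DifferentiableAt ℝ (fun y => (fderiv ℝ G y).flip) x :=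
    (ContinuousLinearMap.flipₗᵢ ℝ E E
      (E →L[ℝ] ℝ)).toContinuousLinearEquiv.differentiableAt.comp x hD
  have hk : DifferentiableAt ℝ (koszul G) x := by
    unfold koszul
    exact (((hD.add hD').sub ((differentiableAt_const _).clm_comp hD')).const_smul (2⁻¹ : ℝ))
  unfold christoffel
  exact ((ContinuousLinearMap.compL ℝ E (E →L[ℝ] ℝ) E).differentiableAt.comp x hi).clm_comp hk

/-- The Gauss equation. -/
theorem gauss_equation [CompleteSpace E] (h : IsPullbackMetric G B Φ U) {x : E} (hx : x ∈ U)
    (X Y Z W : E) :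
    G x (curvature G x X Y Z) W =
      B (secondForm G Φ x Y Z) (secondForm G Φ x X W)
        - B (secondForm G Φ x X Z) (secondForm G Φ x Y W) := by
  have hψ := h.differentiableAt_fderiv hx
  have hΓ := h.differentiableAt_christoffel hx
  have hH : DifferentiableAt ℝ (fderiv ℝ (fderiv ℝ Φ)) x :=
    (contDiffAt_fderiv_fderiv_of_isOpen h.isOpen h.contDiffOn hx).differentiableAt (by simp)
  have key : ∀ X Y, G x (fderiv ℝ (fun y => christoffel G y Y Z) x X
        + christoffel G x X (christoffel G x Y Z)) W =
      B (fderiv ℝ (fderiv ℝ (fderiv ℝ Φ)) x X Y Z) (fderiv ℝ Φ x W)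
        + B (secondForm G Φ x Y Z) (secondForm G Φ x X W) := by
    intro X Y
    -- The defining identity of `Γ(Y, Z)` holds on all of `U`, so it may be differentiated along
    -- `X`. This produces the derivative of `Γ` without differentiating the inverse of `G`
    -- explicitly.
    have e : (fun y => B (fderiv ℝ Φ y (christoffel G y Y Z)) (fderiv ℝ Φ y W)) =ᶠ[nhds x]
        fun y => B (fderiv ℝ (fderiv ℝ Φ) y Y Z) (fderiv ℝ Φ y W) := by
      filter_upwards [h.isOpen.mem_nhds hx] with y hy
      rw [← h.metric_christoffel_eq hy, h.apply_eq y hy]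
    have e' := congrArg (fun T : E →L[ℝ] ℝ => T X) e.fderiv_eq
    have hΓ' : DifferentiableAt ℝ (fun y => christoffel G y Y Z) x := by fun_prop
    rw [fderiv_bilin B (by fun_prop) (by fun_prop),
      fderiv_bilin B (by fun_prop) (by fun_prop),
      fderiv_clm_apply_const hψ, fderiv_clm_apply hψ hΓ',
      fderiv_clm_apply_const (f := fun y => fderiv ℝ (fderiv ℝ Φ) y Y) (by fun_prop),
      fderiv_clm_apply_const hH] at e'
    have e1 := h.metric_christoffel_eq hx X (christoffel G x Y Z) W
    -- Against a normal vector, the Hessian of `Φ` may be replaced by the second fundamental form: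
    -- they differ by a tangent vector.
    have e2 : B (secondForm G Φ x Y Z) (secondForm G Φ x X W) =
        B (secondForm G Φ x Y Z) (fderiv ℝ (fderiv ℝ Φ) x X W) := by
      conv_lhs => rw [secondForm.eq_1 G Φ x X W]
      rw [map_sub, h.secondForm_normal hx, sub_zero]
    rw [e2, map_add, add_apply, e1, h.apply_eq x hx, secondForm, map_sub,
      sub_apply]
    simp only [add_apply, ContinuousLinearMap.comp_apply,
      ContinuousLinearMap.flip_apply, map_add] at e'
    linarith
  -- The third-derivative term of `key` is symmetric in `X` and `Y`, so it drops out of the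
  -- curvature.
  have hs : fderiv ℝ (fderiv ℝ (fderiv ℝ Φ)) x X Y = fderiv ℝ (fderiv ℝ (fderiv ℝ Φ)) x Y X :=
    (contDiffAt_fderiv_of_isOpen h.isOpen h.contDiffOn hx).isSymmSndFDerivAt (by simp; decide) X Y
  have k1 := key X Y
  have k2 := key Y X
  rw [hs] at k1
  have : curvature G x X Y Z = (fderiv ℝ (fun y => christoffel G y Y Z) x X
        + christoffel G x X (christoffel G x Y Z)) - (fderiv ℝ (fun y => christoffel G y X Z) x Y
        + christoffel G x Y (christoffel G x X Z)) := by
    rw [curvature]; abel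
  rw [this, map_sub, sub_apply, k1, k2]
  ring

end IsPullbackMetric

/-! ### Maps into quadrics -/

/-- If a map takes values in a quadric `B (L v) v = const`, its differential is orthogonal to `L Φ`. -/
theorem quadric_tangent (hU : IsOpen U) (hΦ : ContDiffOn ℝ ∞ Φ U) {L : F →L[ℝ] F}
    (hs : ∀ v w, B v w = B w v) (hL : ∀ v w, B (L v) w = B v (L w)) {k : ℝ}
    (hc : ∀ x ∈ U, B (L (Φ x)) (Φ x) = k) {x : E} (hx : x ∈ U) (X : E) :
    B (L (Φ x)) (fderiv ℝ Φ x X) = 0 := by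
  have hd : DifferentiableAt ℝ Φ x :=
    (hΦ.contDiffAt (hU.mem_nhds hx)).differentiableAt (by simp)
  have e : (fun y => (B ∘L L) (Φ y) (Φ y)) =ᶠ[nhds x] fun _ => k := by
    filter_upwards [hU.mem_nhds hx] with y hy using hc y hy
  have e' := congrArg (fun T : E →L[ℝ] ℝ => T X) e.fderiv_eq
  rw [fderiv_bilin (B ∘L L) hd hd] at e'
  simp only [ContinuousLinearMap.comp_apply, fderiv_fun_const, Pi.zero_apply,
    zero_apply] at e'
  rw [hL (fderiv ℝ Φ x X), hs (fderiv ℝ Φ x X)] at e'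
  linarith

/-- The component along `L Φ` of the second derivative of a map into a quadric. -/
theorem quadric_second (hU : IsOpen U) (hΦ : ContDiffOn ℝ ∞ Φ U) {L : F →L[ℝ] F}
    (hs : ∀ v w, B v w = B w v) (hL : ∀ v w, B (L v) w = B v (L w)) {k : ℝ}
    (hc : ∀ x ∈ U, B (L (Φ x)) (Φ x) = k) {x : E} (hx : x ∈ U) (X Y : E) :
    B (fderiv ℝ (fderiv ℝ Φ) x X Y) (L (Φ x)) = - B (fderiv ℝ Φ x X) (L (fderiv ℝ Φ x Y)) := by
  have hd : DifferentiableAt ℝ Φ x :=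
    (hΦ.contDiffAt (hU.mem_nhds hx)).differentiableAt (by simp)
  have hψ : DifferentiableAt ℝ (fderiv ℝ Φ) x :=
    (contDiffAt_fderiv_of_isOpen hU hΦ hx).differentiableAt (by simp)
  have e : (fun y => (B ∘L L) (Φ y) (fderiv ℝ Φ y Y)) =ᶠ[nhds x] fun _ => 0 := by
    filter_upwards [hU.mem_nhds hx] with y hy using quadric_tangent hU hΦ hs hL hc hy Y
  have e' := congrArg (fun T : E →L[ℝ] ℝ => T X) e.fderiv_eq
  rw [fderiv_bilin (B ∘L L) hd (by fun_prop), fderiv_clm_apply_const hψ] at e'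
  simp only [ContinuousLinearMap.comp_apply, fderiv_fun_const, Pi.zero_apply,
    zero_apply] at e'
  rw [hL (fderiv ℝ Φ x X), hs (L (Φ x))] at e'
  linarith

/-- The normal component, along `L Φ`, of the second fundamental form of a map into a quadric. -/
theorem IsPullbackMetric.secondForm_quadric (h : IsPullbackMetric G B Φ U) {L : F →L[ℝ] F}
    (hL : ∀ v w, B (L v) w = B v (L w)) {k : ℝ}
    (hc : ∀ x ∈ U, B (L (Φ x)) (Φ x) = k) {x : E} (hx : x ∈ U) (X Y : E) :
    B (secondForm G Φ x X Y) (L (Φ x)) = - B (fderiv ℝ Φ x X) (L (fderiv ℝ Φ x Y)) := by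
  rw [secondForm, map_sub, sub_apply,
    quadric_second h.isOpen h.contDiffOn h.symm hL hc hx, h.symm (fderiv ℝ Φ x (christoffel G x X Y)),
    quadric_tangent h.isOpen h.contDiffOn h.symm hL hc hx, sub_zero]

end Gauss

end PseudoRiem

/-! ### The tangent map and the complete lift -/

namespace PseudoRiem

section TangentLift

variable {E F : Type*} [NormedAddCommGroup E] [NormedSpace ℝ E]
  [NormedAddCommGroup F] [NormedSpace ℝ F]

/-- A nondegenerate bilinear form on a finite-dimensional space is invertible. -/
theorem isInvertible_of_nondegenerate [FiniteDimensional ℝ E] (T : E →L[ℝ] E →L[ℝ] ℝ)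
    (h : ∀ X, (∀ Y, T X Y = 0) → X = 0) : T.IsInvertible := by
  have hinj : Function.Injective (T : E →ₗ[ℝ] E →L[ℝ] ℝ) := by
    rw [injective_iff_map_eq_zero]
    intro X hX
    refine h X fun Y => ?_
    have : T X = 0 := hX
    rw [this, zero_apply]
  have hdim : Module.finrank ℝ E = Module.finrank ℝ (E →L[ℝ] ℝ) := by
    rw [← (LinearMap.toContinuousLinearMap (𝕜 := ℝ) (E := E) (F' := ℝ)).finrank_eq]
    exact (Subspace.dual_finrank_eq (K := ℝ) (V := E)).symm
  refine ⟨(LinearEquiv.ofInjectiveOfFinrankEq _ hinj hdim).toContinuousLinearEquiv, ?_⟩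
  ext X Y
  rfl

/-- The flat complete lift of a constant bilinear form. -/
noncomputable def tangentForm (B : F →L[ℝ] F →L[ℝ] ℝ) : F × F →L[ℝ] F × F →L[ℝ] ℝ :=
  B.bilinearComp (ContinuousLinearMap.fst ℝ F F) (ContinuousLinearMap.snd ℝ F F)
    + B.bilinearComp (ContinuousLinearMap.snd ℝ F F) (ContinuousLinearMap.fst ℝ F F)

theorem tangentForm_apply (B : F →L[ℝ] F →L[ℝ] ℝ) (v w : F × F) :
    tangentForm B v w = B v.1 w.2 + B v.2 w.1 := by
  simp [tangentForm]

/-- The tangent map `(x, u) ↦ (Φ x, dΦ_x u)`. -/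
noncomputable def tangentMap (Φ : E → F) (p : E × E) : F × F := (Φ p.1, fderiv ℝ Φ p.1 p.2)

variable {G : E → E →L[ℝ] E →L[ℝ] ℝ} {B : F →L[ℝ] F →L[ℝ] ℝ} {Φ : E → F} {U : Set E}

theorem contDiffOn_tangentMap (hU : IsOpen U) (h : ContDiffOn ℝ ∞ Φ U) :
    ContDiffOn ℝ ∞ (tangentMap Φ) (U ×ˢ Set.univ) := by
  intro p hp
  have h1 : ContDiffAt ℝ ∞ Φ p.1 := h.contDiffAt (hU.mem_nhds hp.1)
  have h2 : ContDiffAt ℝ ∞ (fderiv ℝ Φ) p.1 := contDiffAt_fderiv_of_isOpen hU h hp.1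
  exact ((h1.comp p contDiffAt_fst).prodMk
    ((h2.comp p contDiffAt_fst).clm_apply contDiffAt_snd)).contDiffWithinAt

theorem fderiv_tangentMap (hU : IsOpen U) (h : ContDiffOn ℝ ∞ Φ U) {p : E × E} (hp : p.1 ∈ U)
    (ζ : E × E) :
    fderiv ℝ (tangentMap Φ) p ζ =
      (fderiv ℝ Φ p.1 ζ.1, fderiv ℝ (fderiv ℝ Φ) p.1 ζ.1 p.2 + fderiv ℝ Φ p.1 ζ.2) := by
  have h1 : HasFDerivAt Φ (fderiv ℝ Φ p.1) p.1 :=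
    ((h.contDiffAt (hU.mem_nhds hp)).differentiableAt (by simp)).hasFDerivAt
  have h2 : HasFDerivAt (fderiv ℝ Φ) (fderiv ℝ (fderiv ℝ Φ) p.1) p.1 :=
    ((contDiffAt_fderiv_of_isOpen hU h hp).differentiableAt (by simp)).hasFDerivAt
  have h3 : HasFDerivAt (fun q : E × E => q.1) (ContinuousLinearMap.fst ℝ E E) p := hasFDerivAt_fst
  have h4 : HasFDerivAt (fun q : E × E => q.2) (ContinuousLinearMap.snd ℝ E E) p := hasFDerivAt_snd
  have h5 : HasFDerivAt (tangentMap Φ) _ p :=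
    (h1.comp p h3).prodMk ((h2.comp p h3).clm_apply h4)
  rw [h5.fderiv]
  ext <;> simp [add_comm]

theorem completeLift_apply (p ζ ζ' : E × E) :
    completeLift G p ζ ζ' = G p.1 ζ.1 (vPart G p ζ') + G p.1 (vPart G p ζ) ζ'.1 := by
  simp [completeLift]

theorem vPart_apply (p ζ : E × E) : vPart G p ζ = ζ.2 + christoffel G p.1 ζ.1 p.2 := by
  simp [vPart]

namespace IsPullbackMetric

theorem metric_symm (h : IsPullbackMetric G B Φ U) {x : E} (hx : x ∈ U) (X Y : E) :
    G x X Y = G x Y X := by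
  rw [h.apply_eq x hx, h.apply_eq x hx, h.symm]

theorem metric_nondegenerate (h : IsPullbackMetric G B Φ U) {x : E} (hx : x ∈ U) (X : E)
    (hX : ∀ Y, G x X Y = 0) : X = 0 := by
  apply (h.isInvertible x hx).injective
  ext Y
  simp [hX Y]

/-- The complete lift of a pull-back metric is the pull-back under the tangent map. -/
theorem completeLift [FiniteDimensional ℝ E] (h : IsPullbackMetric G B Φ U) :
    IsPullbackMetric (completeLift G) (tangentForm B) (tangentMap Φ) (U ×ˢ Set.univ) where
  isOpen := h.isOpen.prod isOpen_univ
  contDiffOn := contDiffOn_tangentMap h.isOpen h.contDiffOn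
  symm v w := by
    rw [tangentForm_apply, tangentForm_apply, h.symm v.1, h.symm v.2, add_comm]
  apply_eq p hp ζ ζ' := by
    have hx : p.1 ∈ U := hp.1
    -- The Christoffel terms of the two vertical parts match the Hessian terms in the differential
    -- of the tangent map.
    rw [fderiv_tangentMap h.isOpen h.contDiffOn hx, fderiv_tangentMap h.isOpen h.contDiffOn hx,
      tangentForm_apply, completeLift_apply, vPart_apply, vPart_apply, map_add, map_add, map_add,
      map_add, add_apply, add_apply, h.metric_symm hx ζ.1 (christoffel _ _ _ _),
      h.metric_christoffel_eq hx, h.metric_christoffel_eq hx, h.apply_eq _ hx, h.apply_eq _ hx,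
      h.symm (fderiv ℝ Φ p.1 ζ.1) (fderiv ℝ (fderiv ℝ Φ) p.1 ζ'.1 p.2)]
    ring
  isInvertible p hp := by
    have hx : p.1 ∈ U := hp.1
    -- Pairing with vertical lifts kills the horizontal part of `ζ`; pairing with horizontal lifts
    -- then kills the vertical part.
    refine isInvertible_of_nondegenerate _ fun ζ hζ => ?_
    have h1 : ζ.1 = 0 := by
      refine h.metric_nondegenerate hx _ fun Y => ?_
      have := hζ (vLift Y)
      simpa [completeLift_apply] using this
    have h2 : vPart G p ζ = 0 := by
      refine h.metric_nondegenerate hx _ fun Y => ?_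
      have := hζ (hLift G p Y)
      simpa [completeLift_apply, h1] using this
    rw [← hLift_add_vLift G p ζ, h1, h2]
    simp

/-- The differential of the tangent map in terms of horizontal and vertical parts. -/
theorem fderiv_tangentMap_eq (h : IsPullbackMetric G B Φ U) {p : E × E} (hp : p.1 ∈ U)
    (ζ : E × E) :
    fderiv ℝ (tangentMap Φ) p ζ =
      (fderiv ℝ Φ p.1 ζ.1, fderiv ℝ Φ p.1 (vPart G p ζ) + secondForm G Φ p.1 ζ.1 p.2) := by
  rw [fderiv_tangentMap h.isOpen h.contDiffOn hp, vPart_apply, secondForm, map_add]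
  congr 1
  abel

/-- The component of the second fundamental form of the tangent map along the complete lift of a
normal field `L Φ` coming from a quadric. -/
theorem secondForm_tangentMap [FiniteDimensional ℝ E] (h : IsPullbackMetric G B Φ U)
    {L : F →L[ℝ] F} {l : E →L[ℝ] E} (hL : ∀ v w, B (L v) w = B v (L w)) {k : ℝ}
    (hc : ∀ x ∈ U, B (L (Φ x)) (Φ x) = k)
    (hl : ∀ x ∈ U, ∀ X, fderiv ℝ Φ x (l X) = L (fderiv ℝ Φ x X))
    {p : E × E} (hp : p.1 ∈ U) (ζ ζ' : E × E) :
    tangentForm B (secondForm (PseudoRiem.completeLift G) (tangentMap Φ) p ζ ζ')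
        (L (Φ p.1), L (fderiv ℝ Φ p.1 p.2))
      = - (G p.1 ζ.1 (l (vPart G p ζ')) + G p.1 (vPart G p ζ) (l ζ'.1)) := by
  have hLL : ∀ v, L.prodMap L v = (L v.1, L v.2) := fun v => rfl
  have hL' : ∀ v w, tangentForm B (L.prodMap L v) w = tangentForm B v (L.prodMap L w) := by
    intro v w
    simp [tangentForm_apply, hL]
  -- The derivative of the quadric equation along `u` is again a quadric equation, for `L × L` and
  -- with constant `0`.
  have hc' : ∀ q ∈ U ×ˢ (Set.univ : Set E),
      tangentForm B (L.prodMap L (tangentMap Φ q)) (tangentMap Φ q) = 0 := by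
    intro q hq
    simp only [tangentForm_apply, tangentMap, hLL]
    rw [h.symm (L (fderiv ℝ Φ q.1 q.2)), ← hL,
      quadric_tangent h.isOpen h.contDiffOn h.symm hL hc hq.1, add_zero]
  have key := h.completeLift.secondForm_quadric hL' hc' ⟨hp, Set.mem_univ _⟩ ζ ζ'
  rw [h.fderiv_tangentMap_eq hp, h.fderiv_tangentMap_eq hp] at key
  simp only [tangentForm_apply, tangentMap, hLL, map_add, add_apply] at key ⊢
  -- Moving `L` onto the tangent vector leaves it tangent, by `hl`, so its pairing with the normal
  -- part vanishes.
  rw [← hL _ (secondForm G Φ p.1 ζ'.1 p.2)] at key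
  simp only [← hl _ hp, h.secondForm_normal hp, ← h.apply_eq _ hp,
    h.symm _ (secondForm G Φ p.1 ζ'.1 p.2)] at key ⊢
  rw [key]
  ring

/-- The component of the second fundamental form of the tangent map along the vertical lift of a
normal field `L Φ` coming from a quadric. -/
theorem secondForm_tangentMap_vertical [FiniteDimensional ℝ E] (h : IsPullbackMetric G B Φ U)
    {L : F →L[ℝ] F} {l : E →L[ℝ] E} (hL : ∀ v w, B (L v) w = B v (L w)) {k : ℝ}
    (hc : ∀ x ∈ U, B (L (Φ x)) (Φ x) = k)
    (hl : ∀ x ∈ U, ∀ X, fderiv ℝ Φ x (l X) = L (fderiv ℝ Φ x X))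
    {p : E × E} (hp : p.1 ∈ U) (ζ ζ' : E × E) :
    tangentForm B (secondForm (PseudoRiem.completeLift G) (tangentMap Φ) p ζ ζ') (0, L (Φ p.1))
      = - G p.1 ζ.1 (l ζ'.1) := by
  -- For `(v, v') ↦ (0, L v)` the quadric in `F × F` is the original equation, pulled back from the
  -- base.
  let V : F × F →L[ℝ] F × F := ContinuousLinearMap.inr ℝ F F ∘L L ∘L ContinuousLinearMap.fst ℝ F F
  have hL' : ∀ v w, tangentForm B (V v) w = tangentForm B v (V w) := by
    intro v w
    simp [tangentForm_apply, hL, V]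
  have hc' : ∀ q ∈ U ×ˢ (Set.univ : Set E),
      tangentForm B (V (tangentMap Φ q)) (tangentMap Φ q) = k := by
    intro q hq
    simpa [tangentForm_apply, tangentMap, V] using hc q.1 hq.1
  have key := h.completeLift.secondForm_quadric hL' hc' ⟨hp, Set.mem_univ _⟩ ζ ζ'
  rw [h.fderiv_tangentMap_eq hp, h.fderiv_tangentMap_eq hp] at key
  simp only [tangentMap, V, ContinuousLinearMap.comp_apply, ContinuousLinearMap.coe_fst',
    ContinuousLinearMap.inr_apply] at key
  rw [key, tangentForm_apply]
  simp [h.apply_eq _ hp, hl _ hp]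

end IsPullbackMetric

end TangentLift

end PseudoRiem

/-! ### Algebra of the standard Norden metric -/

namespace NordenSpace

variable (m : ℕ)

theorem J_J (z : NordenSpace m) : J m (J m z) = -z := by
  ext <;> simp [J_apply]

theorem g_symm (z w : NordenSpace m) : g m z w = g m w z := by
  simp only [g_apply, mul_comm]

theorem g_J_left (z w : NordenSpace m) : g m (J m z) w = g m z (J m w) := by
  simp only [g_apply, J_apply, Pi.neg_apply]
  exact Finset.sum_congr rfl fun i _ => by ring

theorem eq_zero_of_g_eq_zero {z : NordenSpace m} (h : ∀ w, g m z w = 0) : z = 0 := by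
  ext i
  · simpa [g_apply, Pi.single_apply] using h (Pi.single i 1, 0)
  · simpa [g_apply, Pi.single_apply] using h (0, Pi.single i 1)

end NordenSpace

/-! ### Normal space and curvature of the tangent bundle of the h-sphere -/

namespace PseudoRiem

variable {E : Type*} [NormedAddCommGroup E] [NormedSpace ℝ E]

/-- With `(X, X')` standing for the vector `X^H + X'^V`, the numerators `g(II(v₁,v₂), II(v₃,v₄))`,
multiplied by `a² + b²`, for the second fundamental form `II` of the tangent bundle of an h-sphere with
parameters `a`, `b`. -/
noncomputable def gaussForm (a b : ℝ) (m : E →L[ℝ] E →L[ℝ] ℝ) (J : E →L[ℝ] E) (v₁ v₂ v₃ v₄ : E × E) : ℝ :=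
  (a * m v₁.1 v₂.1 + b * m v₁.1 (J v₂.1)) * (m v₃.1 v₄.2 + m v₃.2 v₄.1)
    + (b * m v₁.1 v₂.1 - a * m v₁.1 (J v₂.1)) * (m v₃.1 (J v₄.2) + m v₃.2 (J v₄.1))
    + (a * (m v₁.1 v₂.2 + m v₁.2 v₂.1) + b * (m v₁.1 (J v₂.2) + m v₁.2 (J v₂.1))) * m v₃.1 v₄.1
    + (b * (m v₁.1 v₂.2 + m v₁.2 v₂.1) - a * (m v₁.1 (J v₂.2) + m v₁.2 (J v₂.1)))
      * m v₃.1 (J v₄.1)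

end PseudoRiem

namespace HSphereChart

open PseudoRiem

variable {n : ℕ} {z₀ : NordenSpace (n + 1)} {a b : ℝ}

/-- The position vector relative to the center. -/
noncomputable def position (c : HSphereChart n z₀ a b) (x : NordenSpace n) : NordenSpace (n + 1) :=
  c.φ x - z₀

theorem fderiv_position (c : HSphereChart n z₀ a b) : fderiv ℝ c.position = fderiv ℝ c.φ := by
  ext1 x
  exact fderiv_sub_const _

theorem contDiffOn_position (c : HSphereChart n z₀ a b) : ContDiffOn ℝ ∞ c.position c.U :=
  c.contDiffOn.sub contDiffOn_const

theorem sq_add_sq_ne_zero_of_ne (hab : (a, b) ≠ (0, 0)) : a ^ 2 + b ^ 2 ≠ 0 := by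
  intro h
  apply hab
  have ha : a = 0 := by nlinarith [sq_nonneg a, sq_nonneg b]
  have hb : b = 0 := by nlinarith [sq_nonneg a, sq_nonneg b]
  rw [ha, hb]

theorem g_position (c : HSphereChart n z₀ a b) {x : NordenSpace n} (hx : x ∈ c.U) :
    NordenSpace.g (n + 1) (c.position x) (c.position x) = a :=
  (c.mapsTo hx).1

theorem g_position_J (c : HSphereChart n z₀ a b) {x : NordenSpace n} (hx : x ∈ c.U) :
    NordenSpace.g (n + 1) (c.position x) (NordenSpace.J (n + 1) (c.position x)) = b :=
  (c.mapsTo hx).2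

theorem g_J_position (c : HSphereChart n z₀ a b) {x : NordenSpace n} (hx : x ∈ c.U) :
    NordenSpace.g (n + 1) (NordenSpace.J (n + 1) (c.position x)) (c.position x) = b := by
  rw [NordenSpace.g_J_left, c.g_position_J hx]

theorem fderiv_position_J (c : HSphereChart n z₀ a b) {x : NordenSpace n} (hx : x ∈ c.U)
    (X : NordenSpace n) : fderiv ℝ c.position x (NordenSpace.J n X) =
      NordenSpace.J (n + 1) (fderiv ℝ c.position x X) := by
  rw [fderiv_position]
  exact c.holomorphic x hx X

theorem g_position_fderiv (c : HSphereChart n z₀ a b) {x : NordenSpace n} (hx : x ∈ c.U)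
    (X : NordenSpace n) :
    NordenSpace.g (n + 1) (c.position x) (fderiv ℝ c.position x X) = 0 :=
  quadric_tangent (L := ContinuousLinearMap.id ℝ _) (k := a) c.isOpen_U c.contDiffOn_position
    (NordenSpace.g_symm _) (fun _ _ => rfl) (fun _ h => c.g_position h) hx X

theorem g_position_J_fderiv (c : HSphereChart n z₀ a b) {x : NordenSpace n} (hx : x ∈ c.U)
    (X : NordenSpace n) : NordenSpace.g (n + 1) (c.position x)
      (NordenSpace.J (n + 1) (fderiv ℝ c.position x X)) = 0 := by
  rw [← c.fderiv_position_J hx, c.g_position_fderiv hx]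

/-- The normal space is spanned by the position vector and its image under `J`. -/
theorem exists_eq_of_normal (hab : (a, b) ≠ (0, 0)) (c : HSphereChart n z₀ a b)
    {x : NordenSpace n} (hx : x ∈ c.U) {A : NordenSpace (n + 1)}
    (hA : ∀ X, NordenSpace.g (n + 1) A (fderiv ℝ c.position x X) = 0) :
    ∃ s t : ℝ, A = s • c.position x + t • NordenSpace.J (n + 1) (c.position x) := by
  have hD := sq_add_sq_ne_zero_of_ne hab
  have haa := c.g_position hx
  have hb1 := c.g_position_J hx
  have hb2 := c.g_J_position hx
  -- The Gram matrix of `P` and `JP` is `[[a, b], [b, -a]]`, of determinant `-(a² + b²)`, so these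
  -- two vectors span a nondegenerate plane.
  have hJJ : NordenSpace.g (n + 1) (NordenSpace.J (n + 1) (c.position x))
      (NordenSpace.J (n + 1) (c.position x)) = -a := by
    rw [NordenSpace.g_J_left, NordenSpace.J_J, map_neg, haa]
  have ht1 := c.g_position_fderiv hx
  have ht2 := c.g_position_J_fderiv hx
  have ht3 : ∀ X, NordenSpace.g (n + 1) (NordenSpace.J (n + 1) (c.position x))
      (fderiv ℝ c.position x X) = 0 := fun X => by rw [NordenSpace.g_J_left, ht2]
  have himm : Function.Injective (fderiv ℝ c.position x) := by
    rw [fderiv_position]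
    exact c.immersion x hx
  generalize c.position x = v at *
  generalize fderiv ℝ c.position x = T at *
  -- Tangent space plus the span of `P` and `JP`: injectivity and the count `2n + 2` show that this
  -- is everything.
  let S : NordenSpace n × (ℝ × ℝ) →ₗ[ℝ] NordenSpace (n + 1) :=
    (T : NordenSpace n →ₗ[ℝ] NordenSpace (n + 1)).coprod
      ((LinearMap.toSpanSingleton ℝ _ v).coprod
        (LinearMap.toSpanSingleton ℝ _ (NordenSpace.J (n + 1) v)))
  have hS : ∀ X s t, S (X, (s, t)) = T X + (s • v + t • NordenSpace.J (n + 1) v) :=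
    fun X s t => by simp [S]
  have hinj : Function.Injective S := by
    rw [injective_iff_map_eq_zero]
    rintro ⟨X, s, t⟩ h
    rw [hS] at h
    have h1 := congrArg (NordenSpace.g (n + 1) v) h
    have h2 := congrArg (NordenSpace.g (n + 1) (NordenSpace.J (n + 1) v)) h
    simp only [map_add, map_smul, map_zero, ht1, ht3, haa, hb1, hb2, hJJ, smul_eq_mul] at h1 h2
    have hs : s = 0 := by
      have : (a ^ 2 + b ^ 2) * s = 0 := by linear_combination a * h1 + b * h2
      simpa [hD] using this
    have ht : t = 0 := by
      have : (a ^ 2 + b ^ 2) * t = 0 := by linear_combination b * h1 - a * h2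
      simpa [hD] using this
    subst hs ht
    have : X = 0 := himm (by simpa using h)
    simp [this]
  have hdim : Module.finrank ℝ (NordenSpace n × (ℝ × ℝ)) =
      Module.finrank ℝ (NordenSpace (n + 1)) := by
    simp
    ring
  have hsurj : Function.Surjective S :=
    (LinearMap.injective_iff_surjective_of_finrank_eq_finrank hdim).1 hinj
  let p := NordenSpace.g (n + 1) A v
  let q := NordenSpace.g (n + 1) A (NordenSpace.J (n + 1) v)
  -- The Gram matrix is its own inverse up to the factor `a² + b²`; these coefficients are that
  -- inverse applied to `(p, q)`.
  refine ⟨(a * p + b * q) / (a ^ 2 + b ^ 2), (b * p - a * q) / (a ^ 2 + b ^ 2), ?_⟩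
  rw [← sub_eq_zero]
  apply NordenSpace.eq_zero_of_g_eq_zero
  intro w
  obtain ⟨⟨X, s, t⟩, rfl⟩ := hsurj w
  rw [hS]
  simp only [map_sub, map_add, map_smul, sub_apply, add_apply, smul_apply, hA, ht1, ht3, haa, hb1,
    hb2, hJJ, smul_eq_mul]
  simp only [p, q]
  field_simp
  ring

/-- Nondegeneracy: a tangent vector in the radical is normal, hence a combination of `P` and `JP`;
being tangent, it is also orthogonal to both, so its coefficients vanish by nondegeneracy of their
Gram matrix. -/
theorem isPullbackMetric (hab : (a, b) ≠ (0, 0)) (c : HSphereChart n z₀ a b) :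
    IsPullbackMetric c.metric (NordenSpace.g (n + 1)) c.position c.U where
  isOpen := c.isOpen_U
  contDiffOn := c.contDiffOn_position
  symm := NordenSpace.g_symm _
  apply_eq x _ X Y := by
    rw [fderiv_position]
    rfl
  isInvertible x hx := by
    refine isInvertible_of_nondegenerate _ fun X hX => ?_
    obtain ⟨s, t, h⟩ := c.exists_eq_of_normal hab hx (A := fderiv ℝ c.position x X) fun Y => by
      rw [fderiv_position]
      exact hX Y
    have h0 : fderiv ℝ c.position x X = 0 := by
      apply NordenSpace.eq_zero_of_g_eq_zero
      have h1 := congrArg (NordenSpace.g (n + 1) (c.position x)) h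
      have h2 := congrArg (NordenSpace.g (n + 1) (NordenSpace.J (n + 1) (c.position x))) h
      simp only [map_add, map_smul, c.g_position_fderiv hx, NordenSpace.g_J_left,
        c.g_position_J_fderiv hx, NordenSpace.J_J, map_neg, c.g_position hx, c.g_position_J hx,
        smul_eq_mul] at h1 h2
      have hD := sq_add_sq_ne_zero_of_ne hab
      have hs : s = 0 := by
        have : (a ^ 2 + b ^ 2) * s = 0 := by linear_combination -a * h1 - b * h2
        simpa [hD] using this
      have ht : t = 0 := by
        have : (a ^ 2 + b ^ 2) * t = 0 := by linear_combination a * h2 - b * h1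
        simpa [hD] using this
      intro w
      simp [h, hs, ht]
    rw [fderiv_position] at h0
    exact c.immersion x hx (by simpa using h0)

theorem metric_J (c : HSphereChart n z₀ a b) {x : NordenSpace n} (hx : x ∈ c.U)
    (X Y : NordenSpace n) :
    c.metric x (NordenSpace.J n X) Y = c.metric x X (NordenSpace.J n Y) := by
  simp only [metric, ContinuousLinearMap.bilinearComp_apply, c.holomorphic x hx,
    NordenSpace.g_J_left]

/-- The normal space of the tangent bundle of the h-sphere. -/
theorem exists_eq_of_normal_tangentMap (hab : (a, b) ≠ (0, 0)) (c : HSphereChart n z₀ a b)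
    {p : NordenSpace n × NordenSpace n} (hp : p.1 ∈ c.U)
    {N : NordenSpace (n + 1) × NordenSpace (n + 1)}
    (hN : ∀ ζ, tangentForm (NordenSpace.g (n + 1)) N (fderiv ℝ (tangentMap c.position) p ζ) = 0) :
    ∃ s t s' t' : ℝ,
      N.1 = s • c.position p.1 + t • NordenSpace.J (n + 1) (c.position p.1) ∧
      N.2 = s • fderiv ℝ c.position p.1 p.2
        + t • NordenSpace.J (n + 1) (fderiv ℝ c.position p.1 p.2)
        + s' • c.position p.1 + t' • NordenSpace.J (n + 1) (c.position p.1) := by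
  have hN' : ∀ ζ : NordenSpace n × NordenSpace n, _ := fun ζ => by
    have := hN ζ
    rw [fderiv_tangentMap c.isOpen_U c.contDiffOn_position hp, tangentForm_apply] at this
    exact this
  -- Pairing with vertical vectors shows that `N.1` is normal to the h-sphere.
  obtain ⟨s, t, hst⟩ := c.exists_eq_of_normal hab hp (A := N.1) fun X => by
    simpa using hN' (0, X)
  -- After subtracting the complete lift of the normal field `sP + tJP`, the remainder is normal: in
  -- the pairing with `(X, 0)` the Hessian term is turned by `quadric_second` into a product of
  -- first derivatives.
  obtain ⟨s', t', hst'⟩ := c.exists_eq_of_normal hab hp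
      (A := N.2 - (s • fderiv ℝ c.position p.1 p.2
        + t • NordenSpace.J (n + 1) (fderiv ℝ c.position p.1 p.2))) fun X => by
    have h1 := hN' (X, 0)
    have h2 := quadric_second (L := ContinuousLinearMap.id ℝ _) (k := a) c.isOpen_U
      c.contDiffOn_position (NordenSpace.g_symm _) (fun _ _ => rfl) (fun _ h => c.g_position h) hp
      X p.2
    have h3 := quadric_second (L := NordenSpace.J (n + 1)) (k := b) c.isOpen_U
      c.contDiffOn_position (NordenSpace.g_symm _) (NordenSpace.g_J_left _)
      (fun _ h => c.g_J_position h) hp X p.2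
    rw [NordenSpace.g_symm] at h2 h3
    simp only [ContinuousLinearMap.id_apply] at h2
    simp only [hst, map_zero, add_zero, map_add, map_smul, add_apply, smul_apply, smul_eq_mul, h2,
      h3] at h1
    simp only [map_sub, map_add, map_smul, sub_apply, add_apply, smul_apply, smul_eq_mul,
      NordenSpace.g_symm _ _ (fderiv ℝ c.position p.1 X)]
    rw [NordenSpace.g_symm _ N.2] at h1
    linarith
  refine ⟨s, t, s', t', hst, ?_⟩
  rw [sub_eq_iff_eq_add] at hst'
  rw [hst']
  abel

/-- Expansion of `N` in the normal frame. Complete lifts are mutually null, and so are vertical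
lifts; the two kinds pair through `[[a, b], [b, -a]]`, whose inverse supplies the coefficients. `M`
need not be normal. -/
theorem tangentForm_normal (hab : (a, b) ≠ (0, 0)) (c : HSphereChart n z₀ a b)
    {p : NordenSpace n × NordenSpace n} (hp : p.1 ∈ c.U)
    {N M : NordenSpace (n + 1) × NordenSpace (n + 1)}
    (hN : ∀ ζ, tangentForm (NordenSpace.g (n + 1)) N (fderiv ℝ (tangentMap c.position) p ζ) = 0) :
    let B := tangentForm (NordenSpace.g (n + 1))
    let J := NordenSpace.J (n + 1)
    let P := (c.position p.1, fderiv ℝ c.position p.1 p.2)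
    let JP := (J (c.position p.1), J (fderiv ℝ c.position p.1 p.2))
    let VP := ((0 : NordenSpace (n + 1)), c.position p.1)
    let VJP := ((0 : NordenSpace (n + 1)), J (c.position p.1))
    (a ^ 2 + b ^ 2) * B N M =
      (a * B N VP + b * B N VJP) * B M P + (b * B N VP - a * B N VJP) * B M JP
        + (a * B N P + b * B N JP) * B M VP + (b * B N P - a * B N JP) * B M VJP := by
  intro B J P JP VP VJP
  obtain ⟨s, t, s', t', h1, h2⟩ := c.exists_eq_of_normal_tangentMap hab hp hN
  have haa := c.g_position hp
  have hb1 := c.g_position_J hp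
  have ht1 := c.g_position_fderiv hp
  have ht2 := c.g_position_J_fderiv hp
  simp only [B, P, JP, VP, VJP, J, tangentForm_apply, h1, h2]
  simp only [map_add, map_smul, add_apply, smul_apply, smul_eq_mul, NordenSpace.g_J_left,
    NordenSpace.J_J, map_neg, map_zero, zero_apply, haa, hb1, ht1, ht2,
    NordenSpace.g_symm _ (fderiv ℝ c.position p.1 p.2) (c.position p.1),
    NordenSpace.g_symm _ (fderiv ℝ c.position p.1 p.2) (NordenSpace.J (n + 1) (c.position p.1)),
    NordenSpace.g_symm _ M.1, NordenSpace.g_symm _ M.2]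
  ring

/-- Each component of the second fundamental form along the frame is minus a pairing in `m` or `m(·,
J·)`; the signs disappear because the components enter in products of two. -/
theorem gaussForm_eq (hab : (a, b) ≠ (0, 0)) (c : HSphereChart n z₀ a b)
    {p : NordenSpace n × NordenSpace n} (hp : p.1 ∈ c.U)
    (ζ₁ ζ₂ ζ₃ ζ₄ : NordenSpace n × NordenSpace n) :
    (a ^ 2 + b ^ 2) * tangentForm (NordenSpace.g (n + 1))
      (secondForm c.gHat (tangentMap c.position) p ζ₁ ζ₂)
      (secondForm c.gHat (tangentMap c.position) p ζ₃ ζ₄) =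
    gaussForm a b (c.metric p.1) (NordenSpace.J n) (ζ₁.1, vPart c.metric p ζ₁)
      (ζ₂.1, vPart c.metric p ζ₂) (ζ₃.1, vPart c.metric p ζ₃) (ζ₄.1, vPart c.metric p ζ₄) := by
  have h := c.isPullbackMetric hab
  have hn := h.completeLift.secondForm_normal (x := p) ⟨hp, Set.mem_univ _⟩
  have key := c.tangentForm_normal hab hp (M := secondForm c.gHat (tangentMap c.position) p ζ₃ ζ₄)
    (hn ζ₁ ζ₂)
  have e1 := h.secondForm_tangentMap (L := ContinuousLinearMap.id ℝ _)
    (l := ContinuousLinearMap.id ℝ _) (k := a) (fun _ _ => rfl) (fun _ h => c.g_position h)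
    (fun _ _ _ => rfl) hp
  have e2 := h.secondForm_tangentMap_vertical (L := ContinuousLinearMap.id ℝ _)
    (l := ContinuousLinearMap.id ℝ _) (k := a) (fun _ _ => rfl) (fun _ h => c.g_position h)
    (fun _ _ _ => rfl) hp
  have e3 := h.secondForm_tangentMap (L := NordenSpace.J (n + 1))
    (l := NordenSpace.J n) (k := b) (NordenSpace.g_J_left _) (fun _ h => c.g_J_position h)
    (fun _ hx => c.fderiv_position_J hx) hp
  have e4 := h.secondForm_tangentMap_vertical (L := NordenSpace.J (n + 1))
    (l := NordenSpace.J n) (k := b) (NordenSpace.g_J_left _) (fun _ h => c.g_J_position h)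
    (fun _ hx => c.fderiv_position_J hx) hp
  simp only [ContinuousLinearMap.id_apply] at e1 e2
  unfold gHat at key ⊢
  dsimp only at key
  rw [key, e1, e1, e2, e2, e3, e3, e4, e4, gaussForm]
  ring

/-- The sectional curvature of the tangent bundle of the h-sphere. -/
theorem kHat_eq (hab : (a, b) ≠ (0, 0)) (c : HSphereChart n z₀ a b)
    {p : NordenSpace n × NordenSpace n} (hp : p.1 ∈ c.U) (ζ ζ' : NordenSpace n × NordenSpace n) :
    c.kHat p ζ ζ' =
      (gaussForm a b (c.metric p.1) (NordenSpace.J n) (ζ'.1, vPart c.metric p ζ')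
          (ζ'.1, vPart c.metric p ζ') (ζ.1, vPart c.metric p ζ) (ζ.1, vPart c.metric p ζ)
        - gaussForm a b (c.metric p.1) (NordenSpace.J n) (ζ.1, vPart c.metric p ζ)
          (ζ'.1, vPart c.metric p ζ') (ζ'.1, vPart c.metric p ζ') (ζ.1, vPart c.metric p ζ))
        / (a ^ 2 + b ^ 2) / gramDet c.gHat p ζ ζ' := by
  have hD := sq_add_sq_ne_zero_of_ne hab
  rw [kHat, sectionalCurvature, ← c.gaussForm_eq hab hp, ← c.gaussForm_eq hab hp, ← mul_sub,
    mul_div_cancel_left₀ _ hD]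
  congr 1
  exact (c.isPullbackMetric hab).completeLift.gauss_equation ⟨hp, Set.mem_univ _⟩ ζ ζ' ζ' ζ

end HSphereChart

/-! ### Linear algebra of planes, of `H` and of the lifts `ξ`, `η` -/

namespace PseudoRiem

variable {E : Type*} [NormedAddCommGroup E] [NormedSpace ℝ E]

/-- The condition `J P ≠ P` is automatic: if `J P = P`, then `P ⊥ J P` makes the metric vanish on
`P`, against nondegeneracy. -/
theorem isTotallyRealPlane_span_pair {G : E → E →L[ℝ] E →L[ℝ] ℝ} {J : E →L[ℝ] E} {x X Y : E}
    (hg : gramDet G x X Y ≠ 0) (h₁ : G x X (J X) = 0) (h₂ : G x X (J Y) = 0)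
    (h₃ : G x Y (J X) = 0) (h₄ : G x Y (J Y) = 0) :
    IsTotallyRealPlane (G x) J (Submodule.span ℝ {X, Y}) := by
  have h : ∀ Z ∈ Submodule.span ℝ {X, Y}, ∀ W ∈ Submodule.span ℝ {X, Y}, G x Z (J W) = 0 := by
    intro Z hZ W hW
    obtain ⟨s, t, rfl⟩ := Submodule.mem_span_pair.1 hZ
    obtain ⟨s', t', rfl⟩ := Submodule.mem_span_pair.1 hW
    simp [h₁, h₂, h₃, h₄]
  refine ⟨h, fun hP => hg ?_⟩
  have hX : X ∈ Submodule.span ℝ {X, Y} := Submodule.subset_span (by simp)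
  have hY : Y ∈ Submodule.span ℝ {X, Y} := Submodule.subset_span (by simp)
  have h' : ∀ Z ∈ Submodule.span ℝ {X, Y}, ∀ W ∈ Submodule.span ℝ {X, Y}, G x Z W = 0 := by
    intro Z hZ W hW
    rw [← hP] at hW
    obtain ⟨W', hW', rfl⟩ := hW
    exact h Z hZ W' hW'
  simp [gramDet, h' X hX X hX, h' X hX Y hY]

theorem isHolomorphicPlane_span_pair {J : E →L[ℝ] E} {X Y : E} {s t : ℝ} (hs : s ≠ 0) (ht : t ≠ 0)
    (hX : J X = s • Y) (hY : J Y = t • X) : IsHolomorphicPlane J (Submodule.span ℝ {X, Y}) := by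
  rw [IsHolomorphicPlane, Submodule.map_span, Set.image_pair]
  change Submodule.span ℝ {J X, J Y} = _
  rw [hX, hY, Set.pair_comm, Submodule.span_insert, Submodule.span_insert,
    Submodule.span_singleton_smul_eq ht.isUnit, Submodule.span_singleton_smul_eq hs.isUnit]

variable (G : E → E →L[ℝ] E →L[ℝ] ℝ) (J : E →L[ℝ] E) (p : E × E)

theorem hyper_fst_vPart (ζ : E × E) :
    ((hyper G J p 0 ζ).1 = -J ζ.1 ∧ vPart G p (hyper G J p 0 ζ) = J (vPart G p ζ)) ∧
    ((hyper G J p 1 ζ).1 = -vPart G p ζ ∧ vPart G p (hyper G J p 1 ζ) = ζ.1) ∧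
    ((hyper G J p 2 ζ).1 = J (vPart G p ζ) ∧ vPart G p (hyper G J p 2 ζ) = J ζ.1) := by
  simp [hyper]

theorem fst_xi (X : E) : (xi G p X).1 = (1 / √2 : ℝ) • X := by simp [xi]

theorem vPart_xi (X : E) : vPart G p (xi G p X) = (1 / √2 : ℝ) • X := by simp [xi]

theorem fst_eta (X : E) : (eta G p X).1 = (1 / √2 : ℝ) • X := by simp [eta]

theorem vPart_eta (X : E) : vPart G p (eta G p X) = -(1 / √2 : ℝ) • X := by simp [eta]

theorem eq_of_fst_of_vPart {ζ ζ' : E × E} (h₁ : ζ.1 = ζ'.1) (h₂ : vPart G p ζ = vPart G p ζ') :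
    ζ = ζ' := by
  rw [← hLift_add_vLift G p ζ, ← hLift_add_vLift G p ζ', h₁, h₂]

theorem hyper_hyper (hJ : ∀ X, J (J X) = -X) (α : Fin 3) (ζ : E × E) :
    hyper G J p α (hyper G J p α ζ) = -ζ := by
  have h := hyper_fst_vPart G J p
  fin_cases α <;> apply eq_of_fst_of_vPart G p <;> simp [h, hJ]

/-- In the frame of `ξ` and `η` lifts, `H` acts by signed permutations: `J₁` and `J₂` exchange the
two families and `J₃` preserves each. Orthogonality of basic planes thereby becomes a finite check.
-/
theorem hyper_zero_xi (X : E) : hyper G J p 0 (xi G p X) = (-1 : ℝ) • eta G p (J X) := by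
  simp [hyper_lifts, xi, eta]; module

theorem hyper_zero_eta (X : E) : hyper G J p 0 (eta G p X) = (-1 : ℝ) • xi G p (J X) := by
  simp [hyper_lifts, xi, eta]; module

theorem hyper_one_xi (X : E) : hyper G J p 1 (xi G p X) = (-1 : ℝ) • eta G p X := by
  simp [hyper_lifts, xi, eta]; module

theorem hyper_one_eta (X : E) : hyper G J p 1 (eta G p X) = (1 : ℝ) • xi G p X := by
  simp [hyper_lifts, xi, eta]; module

theorem hyper_two_xi (X : E) : hyper G J p 2 (xi G p X) = (1 : ℝ) • xi G p (J X) := by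
  simp [hyper_lifts, xi]; module

theorem hyper_two_eta (X : E) : hyper G J p 2 (eta G p X) = (-1 : ℝ) • eta G p (J X) := by
  simp [hyper_lifts, eta]; module

theorem one_div_sqrt_two_mul_self : (1 / √2 : ℝ) * (1 / √2) = 1 / 2 := by
  rw [div_mul_div_comm, Real.mul_self_sqrt (by norm_num), one_mul]

/-- Exchanging `X^H` and `X^V` is an isometry of `ĝ`, with the `ξ` and `η` lifts as its `±1`
eigenspaces. These are therefore orthogonal, and `ĝ` restricts to `g` on one and `-g` on the other.
-/
theorem completeLift_xi_xi (X Y : E) : completeLift G p (xi G p X) (xi G p Y) = G p.1 X Y := by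
  simp only [completeLift_apply, fst_xi, vPart_xi, map_smul, smul_apply, smul_eq_mul]
  linear_combination (2 * G p.1 X Y) * one_div_sqrt_two_mul_self

theorem completeLift_eta_eta (X Y : E) :
    completeLift G p (eta G p X) (eta G p Y) = -G p.1 X Y := by
  simp only [completeLift_apply, fst_eta, vPart_eta, map_smul, smul_apply, smul_eq_mul]
  linear_combination (-2 * G p.1 X Y) * one_div_sqrt_two_mul_self

theorem completeLift_xi_eta (X Y : E) : completeLift G p (xi G p X) (eta G p Y) = 0 := by
  simp only [completeLift_apply, fst_xi, vPart_xi, fst_eta, vPart_eta, map_smul, smul_apply,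
    smul_eq_mul]
  ring

theorem completeLift_eta_xi (X Y : E) : completeLift G p (eta G p X) (xi G p Y) = 0 := by
  simp only [completeLift_apply, fst_xi, vPart_xi, fst_eta, vPart_eta, map_smul, smul_apply,
    smul_eq_mul]
  ring

/-- The numerator of the sectional curvature vanishes on `J_α`-holomorphic planes. -/
theorem gaussForm_hyper (a b : ℝ) {m : E →L[ℝ] E →L[ℝ] ℝ} (hm : ∀ X Y, m X Y = m Y X)
    (hJ : ∀ X, J (J X) = -X) (hmJ : ∀ X Y, m (J X) Y = m X (J Y)) (α : Fin 3) (ζ : E × E)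
    (s t : ℝ) :
    let v := (ζ.1, vPart G p ζ)
    let w := (s • (hyper G J p α ζ).1 + t • ζ.1,
      s • vPart G p (hyper G J p α ζ) + t • vPart G p ζ)
    gaussForm a b m J w w v v = gaussForm a b m J v w w v := by
  obtain ⟨⟨h1, h2⟩, ⟨h3, h4⟩, h5, h6⟩ := hyper_fst_vPart G J p ζ
  intro v w
  have e1 : m (vPart G p ζ) ζ.1 = m ζ.1 (vPart G p ζ) := hm _ _
  have e2 : m (vPart G p ζ) (J ζ.1) = m ζ.1 (J (vPart G p ζ)) := by rw [← hmJ, hm]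
  -- Once `J` is moved to the right argument, only the values of `m` and `m(·, J·)` on the
  -- horizontal and vertical parts of `ζ` remain, and the claim is a polynomial identity in them for
  -- each `α`.
  fin_cases α <;>
  · simp only [v, w, gaussForm, Fin.zero_eta, Fin.mk_one, Fin.reduceFinMk, h1, h2, h3, h4, h5, h6]
    generalize vPart G p ζ = X' at *
    generalize ζ.1 = X at *
    simp only [map_add, map_smul, map_neg, add_apply, smul_apply, neg_apply, smul_eq_mul, hmJ, hJ,
      e1, e2]
    ring

end PseudoRiem

/-! ### Sectional curvatures of holomorphic and basic planes -/

namespace HSphereChart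

open PseudoRiem

variable {n : ℕ} {z₀ : NordenSpace (n + 1)} {a b : ℝ}

theorem metric_symm (c : HSphereChart n z₀ a b) (x X Y : NordenSpace n) :
    c.metric x X Y = c.metric x Y X :=
  NordenSpace.g_symm _ _ _

/-- Holomorphic planes are flat. -/
theorem kHat_eq_zero_of_holomorphic (hab : (a, b) ≠ (0, 0)) (c : HSphereChart n z₀ a b)
    {p : NordenSpace n × NordenSpace n} (hp : p.1 ∈ c.U) {α : Fin 3}
    {ζ₁ ζ₂ : NordenSpace n × NordenSpace n} (h : c.Holomorphic p α ζ₁ ζ₂) :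
    c.kHat p ζ₁ ζ₂ = 0 := by
  obtain ⟨hg, hP⟩ := h
  have h1 : c.hyper p α ζ₁ ∈ Submodule.span ℝ {ζ₁, ζ₂} := by
    rw [IsHolomorphicPlane] at hP
    rw [← hP]
    exact Submodule.mem_map_of_mem (Submodule.subset_span (by simp))
  obtain ⟨s, t, hst⟩ := Submodule.mem_span_pair.1 h1
  have hJJ : c.hyper p α (c.hyper p α ζ₁) = -ζ₁ :=
    hyper_hyper _ _ _ (NordenSpace.J_J n) α ζ₁
  -- If `J_α ζ₁ = s ζ₁`, then `s² = -1` by `J_α² = -1`, which is impossible. So `ζ₁` and `J_α ζ₁`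
  -- span the plane.
  have ht : t ≠ 0 := by
    rintro rfl
    rw [zero_smul, add_zero] at hst
    rw [← hst, map_smul, ← hst, smul_smul, ← sub_eq_zero, sub_neg_eq_add] at hJJ
    have : (s * s + 1) • ζ₁ = 0 := by rw [add_smul, one_smul, hJJ]
    have h0 : ζ₁ = 0 := (smul_eq_zero.1 this).resolve_left (by nlinarith [mul_self_nonneg s])
    exact hg (by simp [gramDet, h0])
  have h2 : ζ₂ = t⁻¹ • c.hyper p α ζ₁ + (-(t⁻¹ * s)) • ζ₁ := by
    rw [← hst, smul_add, smul_smul, smul_smul, inv_mul_cancel₀ ht]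
    module
  have key := gaussForm_hyper c.metric (NordenSpace.J n) p a b (c.metric_symm p.1)
    (NordenSpace.J_J n) (c.metric_J hp) α ζ₁ t⁻¹ (-(t⁻¹ * s))
  have e1 : ζ₂.1 = t⁻¹ • (c.hyper p α ζ₁).1 + (-(t⁻¹ * s)) • ζ₁.1 := congrArg Prod.fst h2
  have e2 : vPart c.metric p ζ₂ =
      t⁻¹ • vPart c.metric p (c.hyper p α ζ₁) + (-(t⁻¹ * s)) • vPart c.metric p ζ₁ := by
    conv_lhs => rw [h2]
    rw [map_add, map_smul, map_smul]
  rw [c.kHat_eq hab hp, e1, e2]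
  dsimp only at key
  unfold hyper
  rw [key, sub_self, zero_div, zero_div]

/-- The sectional curvature of the basic planes with two different indices. -/
theorem kHat_of_orthogonal (hab : (a, b) ≠ (0, 0)) (c : HSphereChart n z₀ a b)
    {p : NordenSpace n × NordenSpace n} (hp : p.1 ∈ c.U) {X Y : NordenSpace n}
    {ζ ζ' : NordenSpace n × NordenSpace n} {σ τ : ℝ}
    (hζ : ζ.1 = (1 / √2 : ℝ) • X) (hζv : vPart c.metric p ζ = (σ * (1 / √2) : ℝ) • X)
    (hζ' : ζ'.1 = (1 / √2 : ℝ) • Y) (hζv' : vPart c.metric p ζ' = (τ * (1 / √2) : ℝ) • Y)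
    (h₁ : c.metric p.1 X Y = 0) (h₂ : c.metric p.1 X (NordenSpace.J n Y) = 0)
    (h₃ : c.metric p.1 X (NordenSpace.J n X) = 0) (h₄ : c.metric p.1 Y (NordenSpace.J n Y) = 0) :
    c.kHat p ζ ζ' = (σ + τ) / 2 * (c.metric p.1 X X * c.metric p.1 Y Y) * (a / (a ^ 2 + b ^ 2))
      / gramDet c.gHat p ζ ζ' := by
  rw [c.kHat_eq hab hp, hζ, hζv, hζ', hζv', ← mul_div_assoc _ a]
  congr 2
  simp only [gaussForm, map_smul, smul_apply, smul_eq_mul, h₁, h₂, h₃, h₄]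
  have hr := one_div_sqrt_two_mul_self
  generalize (1 / √2 : ℝ) = r at *
  -- Four lifts contribute `r⁴`, and `r⁴ - 1/4 = (r² + 1/2)(r² - 1/2)`.
  linear_combination (2 * (σ + τ) * a * c.metric p.1 X X * c.metric p.1 Y Y * (r * r + 1 / 2)) * hr

/-- The orthogonality relations between `X ∈ {e_i, J e_i}` and `Y ∈ {e_j, J e_j}`. -/
theorem orthogonal_of_basis (c : HSphereChart n z₀ a b) {x : NordenSpace n} (hx : x ∈ c.U)
    {ι : Type*} {e : ι → NordenSpace n}
    (he : IsOrthonormalJBasis c.metric (NordenSpace.J n) x e) {i j : ι} (hij : i ≠ j)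
    {X Y : NordenSpace n} (hX : X ∈ ({e i, NordenSpace.J n (e i)} : Set (NordenSpace n)))
    (hY : Y ∈ ({e j, NordenSpace.J n (e j)} : Set (NordenSpace n))) :
    c.metric x X Y = 0 ∧ c.metric x X (NordenSpace.J n Y) = 0 := by
  obtain ⟨-, -, h3, -, h5⟩ := he
  rcases hX with rfl | rfl <;> rcases hY with rfl | rfl <;>
    simp [c.metric_J hx, NordenSpace.J_J, h3 i j hij, h5]

/-- Self-adjointness of `J` gives `m(JX, JX) = -m(X, X)` and `m(JX, JJX) = -m(X, JX)`, which reduces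
the case of `J e_i` to that of `e_i`. -/
theorem self_of_basis (c : HSphereChart n z₀ a b) {x : NordenSpace n} (hx : x ∈ c.U)
    {ι : Type*} {e : ι → NordenSpace n}
    (he : IsOrthonormalJBasis c.metric (NordenSpace.J n) x e) {i : ι}
    {X : NordenSpace n} (hX : X ∈ ({e i, NordenSpace.J n (e i)} : Set (NordenSpace n))) :
    c.metric x X X ≠ 0 ∧ c.metric x X (NordenSpace.J n X) = 0 := by
  obtain ⟨h1, -, -, -, h5⟩ := he
  have h0 : c.metric x (e i) (e i) ≠ 0 := by
    rcases h1 i with h | h <;> simp [h]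
  rcases hX with rfl | rfl <;> simp [c.metric_J hx, NordenSpace.J_J, h5, h0]

theorem gHat_xi_xi (c : HSphereChart n z₀ a b) (p : NordenSpace n × NordenSpace n)
    (X Y : NordenSpace n) :
    c.gHat p (xi c.metric p X) (xi c.metric p Y) = c.metric p.1 X Y :=
  completeLift_xi_xi _ _ _ _

theorem gHat_eta_eta (c : HSphereChart n z₀ a b) (p : NordenSpace n × NordenSpace n)
    (X Y : NordenSpace n) :
    c.gHat p (eta c.metric p X) (eta c.metric p Y) = -c.metric p.1 X Y :=
  completeLift_eta_eta _ _ _ _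

theorem gHat_xi_eta (c : HSphereChart n z₀ a b) (p : NordenSpace n × NordenSpace n)
    (X Y : NordenSpace n) :
    c.gHat p (xi c.metric p X) (eta c.metric p Y) = 0 :=
  completeLift_xi_eta _ _ _ _

theorem gHat_eta_xi (c : HSphereChart n z₀ a b) (p : NordenSpace n × NordenSpace n)
    (X Y : NordenSpace n) :
    c.gHat p (eta c.metric p X) (xi c.metric p Y) = 0 :=
  completeLift_eta_xi _ _ _ _

/-- The Gram determinant is `m(X, X) m(Y, Y)` for both unmixed planes, so the sign of `k̂` comes
only from `σ + τ = ±2`; for the mixed plane `σ + τ = 0`. -/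
theorem basicPlanes_of_ne (hab : (a, b) ≠ (0, 0)) (c : HSphereChart n z₀ a b)
    {p : NordenSpace n × NordenSpace n} (hp : p.1 ∈ c.U) {X Y : NordenSpace n}
    (h₀ : c.metric p.1 X X ≠ 0) (h₀' : c.metric p.1 Y Y ≠ 0)
    (h₁ : c.metric p.1 X Y = 0) (h₂ : c.metric p.1 X (NordenSpace.J n Y) = 0)
    (h₃ : c.metric p.1 X (NordenSpace.J n X) = 0) (h₄ : c.metric p.1 Y (NordenSpace.J n Y) = 0) :
    let ξ := xi c.metric p
    let η := eta c.metric p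
    ((∀ α, c.TotallyReal p α (ξ X) (ξ Y)) ∧ c.kHat p (ξ X) (ξ Y) = a / (a ^ 2 + b ^ 2)) ∧
    ((∀ α, c.TotallyReal p α (η X) (η Y)) ∧ c.kHat p (η X) (η Y) = -(a / (a ^ 2 + b ^ 2))) ∧
    ((∀ α, c.TotallyReal p α (ξ X) (η Y)) ∧ c.kHat p (ξ X) (η Y) = 0) := by
  intro ξ η
  have h₁' : c.metric p.1 Y X = 0 := by rw [c.metric_symm, h₁]
  have h₂' : c.metric p.1 Y (NordenSpace.J n X) = 0 := by
    rw [← c.metric_J hp, c.metric_symm, h₂]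
  have g1 : gramDet c.gHat p (ξ X) (ξ Y) = c.metric p.1 X X * c.metric p.1 Y Y := by
    simp only [gramDet, ξ, gHat_xi_xi, h₁]; ring
  have g2 : gramDet c.gHat p (η X) (η Y) = c.metric p.1 X X * c.metric p.1 Y Y := by
    simp only [gramDet, η, gHat_eta_eta, h₁]; ring
  have g3 : gramDet c.gHat p (ξ X) (η Y) = -(c.metric p.1 X X * c.metric p.1 Y Y) := by
    simp only [gramDet, ξ, η, gHat_eta_eta, gHat_xi_xi, gHat_xi_eta]; ring
  have hne := mul_ne_zero h₀ h₀'
  have vx : ∀ X, vPart c.metric p (ξ X) = (1 * (1 / √2) : ℝ) • X := fun X => by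
    rw [one_mul]; exact vPart_xi _ _ _
  have vy : ∀ X, vPart c.metric p (η X) = (-1 * (1 / √2) : ℝ) • X := fun X => by
    rw [neg_one_mul]; exact vPart_eta _ _ _
  refine ⟨⟨fun α => ⟨g1 ▸ hne, isTotallyRealPlane_span_pair (g1 ▸ hne) ?_ ?_ ?_ ?_⟩, ?_⟩,
    ⟨fun α => ⟨g2 ▸ hne, isTotallyRealPlane_span_pair (g2 ▸ hne) ?_ ?_ ?_ ?_⟩, ?_⟩,
    ⟨fun α => ⟨g3 ▸ neg_ne_zero.2 hne,
      isTotallyRealPlane_span_pair (g3 ▸ neg_ne_zero.2 hne) ?_ ?_ ?_ ?_⟩, ?_⟩⟩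
  case refine_5 =>
    rw [c.kHat_of_orthogonal hab hp (fst_xi _ _ _) (vx X) (fst_xi _ _ _) (vx Y) h₁ h₂ h₃ h₄, g1]
    field_simp
    norm_num
  case refine_10 =>
    rw [c.kHat_of_orthogonal hab hp (fst_eta _ _ _) (vy X) (fst_eta _ _ _) (vy Y) h₁ h₂ h₃ h₄, g2]
    field_simp
    norm_num [neg_div]
  case refine_15 =>
    rw [c.kHat_of_orthogonal hab hp (fst_xi _ _ _) (vx X) (fst_eta _ _ _) (vy Y) h₁ h₂ h₃ h₄]
    norm_num
  all_goals
    unfold hyper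
    fin_cases α <;>
    simp [ξ, η, hyper_zero_xi, hyper_zero_eta, hyper_one_xi, hyper_one_eta, hyper_two_xi,
      hyper_two_eta, gHat_xi_xi, gHat_xi_eta, gHat_eta_xi, gHat_eta_eta, h₁, h₂, h₃, h₄, h₁', h₂']

/-- The vectors of each listed pair are ordered so that `J_β` sends the first to the second and the
second to minus the first. The other two structures give pairings that are zero between the `ξ` and
`η` families or multiples of `m(X, JX) = 0`. Flatness is the holomorphic case. -/
theorem basicPlanes_of_eq (hab : (a, b) ≠ (0, 0)) (c : HSphereChart n z₀ a b)
    {p : NordenSpace n × NordenSpace n} (hp : p.1 ∈ c.U) {X : NordenSpace n}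
    (h₀ : c.metric p.1 X X ≠ 0) (h₁ : c.metric p.1 X (NordenSpace.J n X) = 0) :
    let ξ := xi c.metric p
    let η := eta c.metric p
    let J := NordenSpace.J n
    ∀ P ∈ ({(0, ξ (J X), η X), (0, η (J X), ξ X), (1, η X, ξ X), (1, η (J X), ξ (J X)),
          (2, ξ X, ξ (J X)), (2, η (J X), η X)} :
            Set (Fin 3 × (NordenSpace n × NordenSpace n) × (NordenSpace n × NordenSpace n))),
      c.Holomorphic p P.1 P.2.1 P.2.2 ∧ (∀ α, α ≠ P.1 → c.TotallyReal p α P.2.1 P.2.2) ∧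
        c.kHat p P.2.1 P.2.2 = 0 := by
  intro ξ η J P hP
  suffices h : gramDet c.gHat p P.2.1 P.2.2 ≠ 0 ∧
      IsHolomorphicPlane (c.hyper p P.1) (Submodule.span ℝ {P.2.1, P.2.2}) ∧
      ∀ α, α ≠ P.1 → c.gHat p P.2.1 (c.hyper p α P.2.1) = 0 ∧
        c.gHat p P.2.1 (c.hyper p α P.2.2) = 0 ∧ c.gHat p P.2.2 (c.hyper p α P.2.1) = 0 ∧
        c.gHat p P.2.2 (c.hyper p α P.2.2) = 0 by
    obtain ⟨hg, hh, ht⟩ := h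
    refine ⟨⟨hg, hh⟩, fun α hα => ?_, c.kHat_eq_zero_of_holomorphic hab hp ⟨hg, hh⟩⟩
    obtain ⟨t1, t2, t3, t4⟩ := ht α hα
    exact ⟨hg, isTotallyRealPlane_span_pair hg t1 t2 t3 t4⟩
  have hJ : ∀ Y, NordenSpace.J n (NordenSpace.J n Y) = -Y := NordenSpace.J_J n
  have hm : ∀ Y Z, c.metric p.1 (NordenSpace.J n Y) Z =
      c.metric p.1 Y (NordenSpace.J n Z) := c.metric_J hp
  have xneg : ∀ Y, xi c.metric p (-Y) = -xi c.metric p Y := fun Y => by simp [xi]; module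
  have yneg : ∀ Y, eta c.metric p (-Y) = -eta c.metric p Y := fun Y => by simp [eta]; module
  have e1 := hyper_zero_xi c.metric (NordenSpace.J n) p
  have e2 := hyper_zero_eta c.metric (NordenSpace.J n) p
  have e3 := hyper_one_xi c.metric (NordenSpace.J n) p
  have e4 := hyper_one_eta c.metric (NordenSpace.J n) p
  have e5 := hyper_two_xi c.metric (NordenSpace.J n) p
  have e6 := hyper_two_eta c.metric (NordenSpace.J n) p
  refine ⟨?_, ?_, fun α hα => ?_⟩
  · rcases hP with rfl | rfl | rfl | rfl | rfl | rfl <;>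
    simp [gramDet, ξ, η, J, gHat_xi_xi, gHat_xi_eta, gHat_eta_xi, gHat_eta_eta, hm, hJ, h₀, h₁]
  · unfold hyper
    rcases hP with rfl | rfl | rfl | rfl | rfl | rfl
    · exact isHolomorphicPlane_span_pair (s := 1) (t := -1) (by simp) (by simp)
        (by simp [ξ, η, J, e1, hJ, yneg]) (by simp [ξ, η, J, e2])
    · exact isHolomorphicPlane_span_pair (s := 1) (t := -1) (by simp) (by simp)
        (by simp [ξ, η, J, e2, hJ, xneg]) (by simp [ξ, η, J, e1])
    · exact isHolomorphicPlane_span_pair (s := 1) (t := -1) (by simp) (by simp) (e4 _) (e3 _)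
    · exact isHolomorphicPlane_span_pair (s := 1) (t := -1) (by simp) (by simp) (e4 _) (e3 _)
    · exact isHolomorphicPlane_span_pair (s := 1) (t := -1) (by simp) (by simp) (e5 _)
        (by simp [ξ, J, e5, hJ, xneg])
    · exact isHolomorphicPlane_span_pair (s := 1) (t := -1) (by simp) (by simp)
        (by simp [η, J, e6, hJ, yneg]) (e6 _)
  · unfold hyper
    rcases hP with rfl | rfl | rfl | rfl | rfl | rfl <;> fin_cases α <;>
    first
    | exact absurd rfl hα
    | simp [ξ, η, J, e1, e2, e3, e4, e5, e6, xneg, yneg, gHat_xi_xi, gHat_xi_eta, gHat_eta_xi,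
        gHat_eta_eta, hm, hJ, h₁]

end HSphereChart

/-! ### Existence of holomorphic charts: the h-sphere as a complex quadric -/

namespace NordenSpace

/-- The identification of `ℝ^{2m}` with `ℂ^m`. -/
noncomputable def toComplex (m : ℕ) : NordenSpace m →L[ℝ] (Fin m → ℂ) :=
  LinearMap.toContinuousLinearMap
    { toFun := fun z k => ⟨z.1 k, z.2 k⟩
      map_add' := fun _ _ => rfl
      map_smul' := fun r z => by ext k; apply Complex.ext <;> simp }

theorem toComplex_apply (m : ℕ) (z : NordenSpace m) (k : Fin m) :
    toComplex m z k = ⟨z.1 k, z.2 k⟩ := rfl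

/-- The identification of `ℂ^m` with `ℝ^{2m}`. -/
noncomputable def ofComplex (m : ℕ) : (Fin m → ℂ) →L[ℝ] NordenSpace m :=
  LinearMap.toContinuousLinearMap
    { toFun := fun w => (fun k => (w k).re, fun k => (w k).im)
      map_add' := fun _ _ => rfl
      map_smul' := fun r z => by ext k <;> simp }

theorem ofComplex_apply (m : ℕ) (w : Fin m → ℂ) :
    ofComplex m w = (fun k => (w k).re, fun k => (w k).im) := rfl

theorem toComplex_ofComplex (m : ℕ) (w : Fin m → ℂ) : toComplex m (ofComplex m w) = w := rfl

theorem ofComplex_toComplex (m : ℕ) (z : NordenSpace m) : ofComplex m (toComplex m z) = z := rfl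

theorem toComplex_J (m : ℕ) (z : NordenSpace m) :
    toComplex m (J m z) = Complex.I • toComplex m z := by
  ext k; apply Complex.ext <;> simp [toComplex_apply, J_apply]

theorem ofComplex_I_smul (m : ℕ) (w : Fin m → ℂ) :
    ofComplex m (Complex.I • w) = J m (ofComplex m w) := by
  ext k <;> simp [ofComplex_apply, J_apply]

theorem sum_toComplex_sq (m : ℕ) (z : NordenSpace m) :
    ∑ k, toComplex m z k ^ 2 = ⟨g m z z, -g m z (J m z)⟩ := by
  apply Complex.ext
  · simp only [Complex.re_sum, g_apply, toComplex_apply, sq, Complex.mul_re]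
  · simp only [Complex.im_sum, g_apply, J_apply, toComplex_apply, sq, Complex.mul_im,
      ← Finset.sum_neg_distrib, Pi.neg_apply]
    exact Finset.sum_congr rfl fun k _ => by ring

/-- Forgetting one complex coordinate. -/
noncomputable def removeCoord {n : ℕ} (k : Fin (n + 1)) : NordenSpace (n + 1) →L[ℝ] NordenSpace n :=
  LinearMap.toContinuousLinearMap
    { toFun := fun z => (fun i => z.1 (k.succAbove i), fun i => z.2 (k.succAbove i))
      map_add' := fun _ _ => rfl
      map_smul' := fun _ _ => rfl }

theorem removeCoord_ofComplex {n : ℕ} (k : Fin (n + 1)) (u : ℂ) (w : NordenSpace n) :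
    removeCoord k (ofComplex (n + 1) (k.insertNth (α := fun _ => ℂ) u (toComplex n w))) = w := by
  have h : ∀ z, removeCoord k z =
    (fun i => z.1 (k.succAbove i), fun i => z.2 (k.succAbove i)) := fun z => rfl
  ext i <;> simp [h, ofComplex_apply, toComplex_apply]

end NordenSpace

namespace ComplexQuadric

variable {n : ℕ}

/-- The quotient `(C - ∑ wᵢ²) / ζ²`, whose square root parametrizes the quadric `∑ zᵢ² = C`. -/
noncomputable def radicand (C ζ : ℂ) (w : Fin n → ℂ) : ℂ := (C - ∑ i, w i ^ 2) / ζ ^ 2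

/-- The holomorphic function `ζ √(radicand)`. -/
noncomputable def lastCoord (C ζ : ℂ) (w : Fin n → ℂ) : ℂ :=
  ζ * Complex.exp (Complex.log (radicand C ζ w) / 2)

/-- The graph parametrization of the quadric `∑ zᵢ² = C`, solved for the coordinate `k`. -/
noncomputable def graph (C ζ : ℂ) (k : Fin (n + 1)) (w : Fin n → ℂ) : Fin (n + 1) → ℂ :=
  k.insertNth (α := fun _ => ℂ) (lastCoord C ζ w) w

theorem contDiff_radicand (C ζ : ℂ) : ContDiff ℂ ∞ (radicand (n := n) C ζ) := by
  unfold radicand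
  exact (contDiff_const.sub (ContDiff.sum fun i _ => (contDiff_apply ℂ ℂ i).pow 2)).div_const _

theorem lastCoord_sq {C ζ : ℂ} (hζ : ζ ≠ 0) {w : Fin n → ℂ} (hw : radicand C ζ w ≠ 0) :
    lastCoord C ζ w ^ 2 = C - ∑ i, w i ^ 2 := by
  rw [lastCoord, mul_pow, ← Complex.exp_nat_mul]
  have : ((2 : ℕ) : ℂ) * (Complex.log (radicand C ζ w) / 2) = Complex.log (radicand C ζ w) := by
    push_cast; ring
  rw [this, Complex.exp_log hw, radicand]
  field_simp

theorem sum_graph_sq {C ζ : ℂ} (hζ : ζ ≠ 0) (k : Fin (n + 1)) {w : Fin n → ℂ}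
    (hw : radicand C ζ w ≠ 0) : ∑ i, graph C ζ k w i ^ 2 = C := by
  rw [Fin.sum_univ_succAbove _ k]
  simp [graph, lastCoord_sq hζ hw]

theorem contDiffAt_graph (C ζ : ℂ) (k : Fin (n + 1)) {w : Fin n → ℂ}
    (hw : radicand C ζ w ∈ Complex.slitPlane) : ContDiffAt ℂ ∞ (graph C ζ k) w := by
  rw [contDiffAt_pi]
  intro i
  refine Fin.succAboveCases k ?_ (fun j => ?_) i
  · simp only [graph, Fin.insertNth_apply_same]
    exact contDiffAt_const.mul
      (((Complex.contDiffAt_log hw).comp w (contDiff_radicand C ζ).contDiffAt).div_const 2).cexp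
  · simp only [graph, Fin.insertNth_apply_succAbove]
    exact (contDiff_apply ℂ ℂ j).contDiffAt

end ComplexQuadric

namespace HSphereChart

open NordenSpace ComplexQuadric

variable {n : ℕ} {z₀ : NordenSpace (n + 1)} {a b : ℝ}

/-- The minus sign arises because `g(z, Jz) = -2 ∑ xᵢ yᵢ` is minus the imaginary part of `∑ zᵢ²`. -/
theorem mem_hSphere_iff (z : NordenSpace (n + 1)) :
    z ∈ hSphere n z₀ a b ↔ ∑ k, toComplex (n + 1) (z - z₀) k ^ 2 = ⟨a, -b⟩ := by
  rw [sum_toComplex_sq, Complex.mk.injEq, neg_inj]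
  rfl

/-- The parametrization of the h-sphere as a graph over all coordinates but the `k`-th. -/
noncomputable def graphMap (z₀ : NordenSpace (n + 1)) (C ζ : ℂ) (k : Fin (n + 1))
    (v : NordenSpace n) : NordenSpace (n + 1) :=
  z₀ + ofComplex (n + 1) (graph C ζ k (toComplex n v))

theorem removeCoord_graphMap (z₀ : NordenSpace (n + 1)) (C ζ : ℂ) (k : Fin (n + 1))
    (v : NordenSpace n) : removeCoord k (graphMap z₀ C ζ k v) = removeCoord k z₀ + v := by
  rw [graphMap, map_add, graph, removeCoord_ofComplex]

theorem hasFDerivAt_graphMap (z₀ : NordenSpace (n + 1)) {C ζ : ℂ} {k : Fin (n + 1)}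
    {v : NordenSpace n} (hv : radicand C ζ (toComplex n v) ∈ Complex.slitPlane) :
    HasFDerivAt (graphMap z₀ C ζ k) (ofComplex (n + 1) ∘L
      (fderiv ℂ (graph C ζ k) (toComplex n v)).restrictScalars ℝ ∘L toComplex n) v := by
  have h := ((contDiffAt_graph C ζ k hv).differentiableAt (by simp)).hasFDerivAt.restrictScalars ℝ
  exact (((ofComplex (n + 1)).hasFDerivAt).comp v
    (h.comp v (toComplex n).hasFDerivAt)).const_add z₀

/-- The chart of the h-sphere given by the graph parametrization. -/
noncomputable def ofGraph (z₀ : NordenSpace (n + 1)) (a b : ℝ) {ζ : ℂ} (hζ : ζ ≠ 0)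
    (k : Fin (n + 1)) : HSphereChart n z₀ a b where
  U := {v | radicand ⟨a, -b⟩ ζ (toComplex n v) ∈ Complex.slitPlane}
  isOpen_U := Complex.isOpen_slitPlane.preimage
    ((contDiff_radicand _ _).continuous.comp (toComplex n).continuous)
  φ := graphMap z₀ ⟨a, -b⟩ ζ k
  contDiffOn v hv := by
    have h := (contDiffAt_graph ⟨a, -b⟩ ζ k hv).restrict_scalars ℝ
    exact (contDiffAt_const.add ((ofComplex (n + 1)).contDiff.contDiffAt.comp v
      (h.comp v (toComplex n).contDiff.contDiffAt))).contDiffWithinAt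
  -- Forgetting the solved coordinate is, up to a translation, a left inverse of the graph map; its
  -- derivative gives the immersion property below.
  injOn v _ w _ h := by
    have := congrArg (removeCoord k) h
    simpa [removeCoord_graphMap] using this
  mapsTo v hv := by
    rw [mem_hSphere_iff, graphMap, add_sub_cancel_left, toComplex_ofComplex]
    exact sum_graph_sq hζ k (Complex.slitPlane_ne_zero hv)
  immersion v hv := by
    have hd : DifferentiableAt ℝ (graphMap z₀ ⟨a, -b⟩ ζ k) v :=
      (hasFDerivAt_graphMap z₀ hv).differentiableAt
    have h1 : HasFDerivAt (fun v => removeCoord k (graphMap z₀ ⟨a, -b⟩ ζ k v))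
        (removeCoord k ∘L fderiv ℝ (graphMap z₀ ⟨a, -b⟩ ζ k) v) v :=
      (removeCoord k).hasFDerivAt.comp v hd.hasFDerivAt
    have h2 : HasFDerivAt (fun v => removeCoord k (graphMap z₀ ⟨a, -b⟩ ζ k v))
        (ContinuousLinearMap.id ℝ (NordenSpace n)) v := by
      simp only [removeCoord_graphMap]
      exact (hasFDerivAt_id v).const_add _
    have h3 := h1.unique h2
    intro X Y hXY
    have := congrArg (removeCoord k) hXY
    rwa [← ContinuousLinearMap.comp_apply, ← ContinuousLinearMap.comp_apply, h3] at this
  -- The real differential is the restriction of scalars of a complex one, so it commutes with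
  -- multiplication by `i`.
  holomorphic v hv X := by
    rw [(hasFDerivAt_graphMap z₀ hv).fderiv]
    simp only [ContinuousLinearMap.comp_apply, ContinuousLinearMap.coe_restrictScalars',
      toComplex_J, map_smul, ofComplex_I_smul]

/-- The h-sphere is covered by charts. -/
theorem exists_chart (hab : (a, b) ≠ (0, 0)) {z : NordenSpace (n + 1)}
    (hz : z ∈ hSphere n z₀ a b) : ∃ c : HSphereChart n z₀ a b, ∃ x ∈ c.U, c.φ x = z := by
  rw [mem_hSphere_iff] at hz
  -- If every coordinate vanished, then `a - ib = ∑ wᵢ² = 0`.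
  obtain ⟨k, hk⟩ : ∃ k, toComplex (n + 1) (z - z₀) k ≠ 0 := by
    by_contra! h
    simp only [h] at hz
    apply hab
    have := Complex.ext_iff.1 hz
    simp at this
    rw [← this.1, ← this.2]
  set w := toComplex (n + 1) (z - z₀) with hw
  have hsum := Fin.sum_univ_succAbove (fun i => w i ^ 2) k
  rw [hz] at hsum
  -- Dividing by the square of the actual coordinate `w k` normalizes the radicand to `1` at the
  -- given point. The point thus lies in the domain of the principal logarithm, and the root is on
  -- the branch through `z`.
  have h1 : radicand ⟨a, -b⟩ (w k) (fun i => w (k.succAbove i)) = 1 := by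
    rw [radicand, hsum, add_sub_cancel_right, div_self (pow_ne_zero 2 hk)]
  refine ⟨ofGraph z₀ a b hk k, ofComplex n (fun i => w (k.succAbove i)), ?_, ?_⟩
  · change radicand _ _ _ ∈ Complex.slitPlane
    rw [toComplex_ofComplex, h1]
    exact Complex.one_mem_slitPlane
  · change graphMap _ _ _ _ _ = z
    have h2 : graph ⟨a, -b⟩ (w k) k (fun i => w (k.succAbove i)) = w := by
      rw [graph, lastCoord, h1]
      simp only [Complex.log_one, zero_div, Complex.exp_zero, mul_one]
      exact Fin.insertNth_self_removeNth k w
    rw [graphMap, toComplex_ofComplex, h2, hw, ofComplex_toComplex, add_sub_cancel]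

end HSphereChart

theorem mainTheorem12 (n : ℕ) (hn : 2 ≤ n) (z₀ : NordenSpace (n + 1)) (a b : ℝ)
    (hab : (a, b) ≠ (0, 0)) :
    -- the h-sphere is covered by charts
    (∀ z ∈ hSphere n z₀ a b, ∃ c : HSphereChart n z₀ a b, ∃ x ∈ c.U, c.φ x = z) ∧
    -- in each chart, at each point `p = (x, u)` of the tangent bundle:
    ∀ (c : HSphereChart n z₀ a b), ∀ x ∈ c.U, ∀ u : NordenSpace n,
      -- all holomorphic planes have vanishing curvature
      (∀ (α : Fin 3) (ζ₁ ζ₂ : NordenSpace n × NordenSpace n),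
        c.Holomorphic (x, u) α ζ₁ ζ₂ → c.kHat (x, u) ζ₁ ζ₂ = 0) ∧
      -- the basic planes
      ∀ e : Fin n → NordenSpace n,
        PseudoRiem.IsOrthonormalJBasis c.metric (NordenSpace.J n) x e →
        let ξ := PseudoRiem.xi c.metric (x, u)
        let η := PseudoRiem.eta c.metric (x, u)
        let J := NordenSpace.J n
        -- the basic planes with two different indices are totally real for all `J_α`
        (∀ i j, i ≠ j →
          ∀ X ∈ ({e i, J (e i)} : Set (NordenSpace n)),
          ∀ Y ∈ ({e j, J (e j)} : Set (NordenSpace n)),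
            ((∀ α, c.TotallyReal (x, u) α (ξ X) (ξ Y)) ∧
              c.kHat (x, u) (ξ X) (ξ Y) = a / (a ^ 2 + b ^ 2)) ∧
            ((∀ α, c.TotallyReal (x, u) α (η X) (η Y)) ∧
              c.kHat (x, u) (η X) (η Y) = -(a / (a ^ 2 + b ^ 2))) ∧
            ((∀ α, c.TotallyReal (x, u) α (ξ X) (η Y)) ∧
              c.kHat (x, u) (ξ X) (η Y) = 0)) ∧
        -- the basic planes with two equal indices are holomorphic for one `J_α` and totally real
        -- for the two others
        (∀ i,
          ∀ P ∈ ({(0, ξ (J (e i)), η (e i)), (0, η (J (e i)), ξ (e i)),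
              (1, η (e i), ξ (e i)), (1, η (J (e i)), ξ (J (e i))),
              (2, ξ (e i), ξ (J (e i))), (2, η (J (e i)), η (e i))} :
                Set (Fin 3 × (NordenSpace n × NordenSpace n) × (NordenSpace n × NordenSpace n))),
            c.Holomorphic (x, u) P.1 P.2.1 P.2.2 ∧
            (∀ α, α ≠ P.1 → c.TotallyReal (x, u) α P.2.1 P.2.2) ∧
            c.kHat (x, u) P.2.1 P.2.2 = 0) := by
  refine ⟨fun z hz => HSphereChart.exists_chart hab hz, fun c x hx u => ⟨fun α ζ₁ ζ₂ h =>
    c.kHat_eq_zero_of_holomorphic hab hx h, fun e he => ?_⟩⟩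
  refine ⟨fun i j hij X hX Y hY => ?_, fun i => ?_⟩
  · obtain ⟨h1, h2⟩ := c.orthogonal_of_basis hx he hij hX hY
    obtain ⟨h3, h4⟩ := c.self_of_basis hx he hX
    obtain ⟨h5, h6⟩ := c.self_of_basis hx he hY
    exact c.basicPlanes_of_ne hab (p := (x, u)) hx h3 h5 h1 h2 h4 h6
  · obtain ⟨h1, h2⟩ := c.self_of_basis hx he (i := i) (X := e i) (Or.inl rfl)
    exact c.basicPlanes_of_eq hab (p := (x, u)) hx h1 h2
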